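/- Let $\mathbb{T}=\{z\in\mathbb{C}:|z|=1\}$, and let $\Phi=(G,\varphi)$ be a finite $\mathbb{T}$-gain graph: $G$ is a finite simple graph, and $\varphi$ assigns to each oriented edge $(u,v)$ of $G$ a gain $\varphi(uv)\in\mathbb{T}$ with $\varphi(vu)=\varphi(uv)^{-1}$. Let $A(\Phi)$ be the Hermitian matrix indexed by $V(G)$ whose $(u,v)$ entry is $\varphi(uv)$ if $uv\in E(G)$ and $0$ otherwise. Let $r(\Phi)$ be the rank of $A(\Phi)$, let $r(G)$ be the rank of the adjacency matrix of $G$, and let $\theta(G)=|E(G)|-|V(G)|+\omega(G)$, where $\omega(G)$ is the number of connected components of $G$. A cycle $C_p$ of $G$ of length $p$, with vertices $v_1,\dots,v_p$ in cyclic order, is of Type A if $p$ is even and $\varphi(v_1v_2)\varphi(v_2v_3)\cdots\varphi(v_pv_1)=(-1)^{p/2}$. A $\delta$-transformation of a graph deletes a vertex of degree $1$ together with its unique neighbour. A crucial subgraph of $G$ is an induced subgraph with no vertex of degree $1$ that is obtained from $G$ by a finite (possibly empty) series of $\delta$-transformations. **Theorem 4.8.** $r(\Phi)=r(G)-2\theta(G)$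 if and only if all of the following conditions hold: 1. distinct cycles of $G$ (if any) have no common vertex; 2. every cycle $C_p$ of $\Phi$ is of Type A and has length $p\equiv 2\pmod 4$; 3. some series of $\delta$-transformations takes $G$ to a crucial subgraph $G_0$ that is the disjoint union of exactly $\theta(G)$ cycles and some (possibly no) isolated vertices. -/

import Mathlib

/-- A complex unit gain graph with vertex set `V`: a simple graph together with a unit complex
number on every oriented edge, inverted when the orientation is reversed. -/
structure TGainGraph (V : Type*) where
  /-- the underlying graph -/
  graph : SimpleGraph V
  /-- the gain of an oriented edge -/
  gain : graph.Dart → Circle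
  gain_symm : ∀ d : graph.Dart, gain d.symm = (gain d)⁻¹

namespace TGainGraph

open Classical in
/-- The Hermitian adjacency matrix of a gain graph. -/
noncomputable def adjMatrix {V : Type*} (Φ : TGainGraph V) : Matrix V V ℂ :=
  Matrix.of fun u v =>
    if h : Φ.graph.Adj u v then ((Φ.gain ⟨(u, v), h⟩ : Circle) : ℂ) else 0

/-- The rank of a gain graph. -/
noncomputable def rank {V : Type*} [Fintype V] (Φ : TGainGraph V) : ℕ :=
  Φ.adjMatrix.rank

/-- The gain of a walk: the product of the gains of its successive oriented edges. -/
noncomputable def walkGain {V : Type*} (Φ : TGainGraph V) {u v : V} (w : Φ.graph.Walk u v) :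
    Circle :=
  (w.darts.map Φ.gain).prod

/-- A cycle of order `p`, given by a closed walk around it, is of Type A if `p` is even and its
gain is `(-1) ^ (p / 2)`. -/
def IsTypeA {V : Type*} (Φ : TGainGraph V) {u : V} (w : Φ.graph.Walk u u) : Prop :=
  Even w.length ∧ ((Φ.walkGain w : Circle) : ℂ) = (-1 : ℂ) ^ (w.length / 2)

end TGainGraph

namespace GraphRank

open Classical in
/-- The rank of the adjacency matrix of a simple graph. -/
noncomputable def graphRank {V : Type*} [Fintype V] (G : SimpleGraph V) : ℕ :=
  (G.adjMatrix ℂ).rank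

/-- The dimension of the cycle space, `|E| - |V| + ω`, where `ω` is the number of connected
components. -/
noncomputable def cycleDim {V : Type*} (G : SimpleGraph V) : ℤ :=
  (Nat.card G.edgeSet : ℤ) - (Nat.card V : ℤ) + (Nat.card G.ConnectedComponent : ℤ)

/-- The set of cycles of a graph, each cycle being regarded as a subgraph. -/
def cycles {V : Type*} (G : SimpleGraph V) : Set G.Subgraph :=
  {C | ∃ (u : V) (w : G.Walk u u), w.IsCycle ∧ w.toSubgraph = C}

/-- Distinct cycles have no common vertex. -/
def CyclesVertexDisjoint {V : Type*} (G : SimpleGraph V) : Prop :=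
  (cycles G).Pairwise fun C D => Disjoint C.verts D.verts

/-- A pendant vertex: a vertex of degree one. -/
def IsPendant {V : Type*} (G : SimpleGraph V) (u : V) : Prop :=
  (G.neighborSet u).ncard = 1

/-- One delta-transformation, on induced subgraphs of `G` given by their vertex sets: the subgraph
induced on `T` arises from the one induced on `S` by deleting a pendant vertex `u` of the latter
together with its neighbour `v`. -/
def DeltaStep {V : Type*} (G : SimpleGraph V) (S T : Set V) : Prop :=
  ∃ u v : S, IsPendant (G.induce S) u ∧ (G.induce S).Adj u v ∧ T = S \ {(u : V), (v : V)}

/-- `S` is the vertex set of a crucial subgraph of `G`: it is reached from `G` by finitely many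
(possibly no) delta-transformations, and the subgraph induced on it has no pendant vertex. -/
def IsCrucial {V : Type*} (G : SimpleGraph V) (S : Set V) : Prop :=
  Relation.ReflTransGen (DeltaStep G) Set.univ S ∧ ∀ u : S, ¬ IsPendant (G.induce S) u

/-- The graph is a cycle, that is, isomorphic to the cycle of order `p` for some `p ≥ 3`. -/
def IsCycleGraph {V : Type*} (G : SimpleGraph V) : Prop :=
  ∃ p : ℕ, 3 ≤ p ∧ Nonempty (G ≃g SimpleGraph.cycleGraph p)

/-- The (finite) graph is the disjoint union of exactly `k` cycles and some (possibly no) isolated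
vertices: every connected component is a cycle or a single vertex, and exactly `k` are cycles. -/
def IsDisjointUnionOfCycles {V : Type*} (G : SimpleGraph V) (k : ℤ) : Prop :=
  (∀ c : G.ConnectedComponent, IsCycleGraph c.toSimpleGraph ∨ ∃ v : V, c.supp = {v}) ∧
    (Nat.card {c : G.ConnectedComponent // IsCycleGraph c.toSimpleGraph} : ℤ) = k

end GraphRank

/-- A gain graph is lower-optimal if its rank is `r(G) - 2 θ(G)`. -/
def TGainGraph.IsLowerOptimal {V : Type*} [Fintype V] (Φ : TGainGraph V) : Prop :=
  (Φ.rank : ℤ) = (GraphRank.graphRank Φ.graph : ℤ) - 2 * GraphRank.cycleDim Φ.graph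

/-! Let `M` be the gain matrix and `N` the adjacency matrix. On every vertex set `S`,
`IsWeighting.rank_sub_le` gives `r(N) - 2θ ≤ r(M)`. As long as there is a cycle, delete one of its
vertices: `r(N)` falls by at most 2, `r(M)` does not rise, and `θ` falls by at least 1. In a forest,
delete a pendant vertex with its neighbour: both ranks fall by exactly 2. Lower-optimality is
equality here, so it passes to all these smaller sets and forces every estimate to be sharp
(`LowerOptimal.of_cycle`, `LowerOptimal.of_pendant`).

Sharpness gives the necessary conditions. A vertex where two cycles diverge would lower `θ` by 2, so
cycles that meet coincide. A neighbour of a pendant vertex lies on no cycle, so pendant steps keep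
`θ`. On a cycle that is a whole component, `r(M)` not dropping yields a kernel vector of `M` nonzero
at the deleted vertex, and `r(N)` dropping by 2 yields a vector that `N` sends to a nonzero multiple
of a basis vector. Propagating the two around the cycle fixes the gain and forces length 2 modulo 4.
The core is `LowerOptimal.isGoodCyc_and_hasCycleShape`: every cycle is good, and without pendant
vertices all degrees are 0 or 2. It works by induction on `S`, using degree counting to find a cycle
attached to the rest by at most one edge.

Conversely, pendant steps preserve `r(M) - r(N)`, so it suffices to treat a disjoint union of good
cycles and isolated vertices (`lowerOptimal_of_ncard`), where the two vectors above are written down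
explicitly, one cycle at a time. -/

open Matrix SimpleGraph GraphRank

/-! ### Rank of a Hermitian matrix when one index is deleted. -/

/-- The matrix obtained by replacing the row and the column of `u` by zero. -/
def Matrix.zeroAt {V R : Type*} [Zero R] [DecidableEq V] (M : Matrix V V R) (u : V) :
    Matrix V V R :=
  Matrix.of fun a b => if a = u ∨ b = u then 0 else M a b

namespace Matrix

section ZeroAt

variable {V : Type*} [Fintype V] [DecidableEq V]

omit [DecidableEq V] in
lemma rank_add_finrank_ker (M : Matrix V V ℂ) :
    M.rank + Module.finrank ℂ (LinearMap.ker M.mulVecLin) = Fintype.card V := by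
  have := LinearMap.finrank_range_add_finrank_ker M.mulVecLin
  rwa [Module.finrank_pi] at this

lemma zeroAt_mulVec_self (M : Matrix V V ℂ) (u : V) (x : V → ℂ) :
    (M.zeroAt u *ᵥ x) u = 0 := by
  simp [mulVec, dotProduct, zeroAt]

lemma mulVec_eq_zeroAt_mulVec_add (M : Matrix V V ℂ) {u w : V} (hw : w ≠ u) (x : V → ℂ) :
    (M *ᵥ x) w = (M.zeroAt u *ᵥ x) w + M w u * x u := by
  simp only [mulVec, dotProduct, zeroAt, of_apply, hw, false_or]
  rw [← Finset.add_sum_erase _ _ (Finset.mem_univ u),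
    ← Finset.add_sum_erase _ (fun b => (if b = u then 0 else M w b) * x b) (Finset.mem_univ u)]
  simp only [if_true, zero_mul, zero_add]
  rw [add_comm]
  congr 1
  refine Finset.sum_congr rfl fun b hb => ?_
  rw [if_neg (Finset.ne_of_mem_erase hb)]

lemma zeroAt_mulVec_single (M : Matrix V V ℂ) (u : V) :
    M.zeroAt u *ᵥ Pi.single u 1 = 0 := by
  ext w
  simp [zeroAt]

lemma rank_zeroAt_le (M : Matrix V V ℂ) (u : V) : (M.zeroAt u).rank ≤ M.rank := by
  have h : M.zeroAt u = diagonal (fun a => if a = u then 0 else 1) * M *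
      diagonal (fun a => if a = u then 0 else 1) := by
    ext a b
    simp only [zeroAt, of_apply, mul_diagonal, diagonal_mul]
    by_cases ha : a = u <;> by_cases hb : b = u <;> simp [ha, hb]
  rw [h]
  exact (rank_mul_le_left _ _).trans (rank_mul_le_right _ _)

/-- On the kernel of `M.zeroAt u`, the `u`-coordinate of a vector and of its image under `M`. -/
def kerCoord (M : Matrix V V ℂ) (u : V) :
    LinearMap.ker (M.zeroAt u).mulVecLin →ₗ[ℂ] ℂ × ℂ :=
  ((LinearMap.proj u).prod ((LinearMap.proj u).comp M.mulVecLin)).comp (Submodule.subtype _)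

lemma kerCoord_apply (M : Matrix V V ℂ) (u : V)
    (x : LinearMap.ker (M.zeroAt u).mulVecLin) :
    kerCoord M u x = ((x : V → ℂ) u, (M *ᵥ (x : V → ℂ)) u) := rfl

lemma mulVec_eq_zero_of_kerCoord (M : Matrix V V ℂ) {u : V} {x : V → ℂ}
    (hx : M.zeroAt u *ᵥ x = 0) (h1 : x u = 0) (h2 : (M *ᵥ x) u = 0) : M *ᵥ x = 0 := by
  ext w
  by_cases hw : w = u
  · subst hw; simpa using h2
  · rw [mulVec_eq_zeroAt_mulVec_add M hw, hx, h1]; simp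

lemma zeroAt_mulVec_eq_zero (M : Matrix V V ℂ) {u : V} {x : V → ℂ}
    (hx : M *ᵥ x = 0) (h1 : x u = 0) : M.zeroAt u *ᵥ x = 0 := by
  ext w
  by_cases hw : w = u
  · subst hw; simp [zeroAt_mulVec_self]
  · have := mulVec_eq_zeroAt_mulVec_add M hw x
    rw [hx, h1] at this
    simpa using this.symm

lemma finrank_ker_kerCoord_le (M : Matrix V V ℂ) (u : V) :
    Module.finrank ℂ (LinearMap.ker (kerCoord M u)) ≤
      Module.finrank ℂ (LinearMap.ker M.mulVecLin) := by
  have : ∀ x : LinearMap.ker (kerCoord M u), ((x : LinearMap.ker (M.zeroAt u).mulVecLin) : V → ℂ) ∈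
      LinearMap.ker M.mulVecLin := by
    rintro ⟨⟨x, hx⟩, h⟩
    rw [LinearMap.mem_ker, kerCoord_apply, Prod.mk_eq_zero] at h
    exact mulVec_eq_zero_of_kerCoord M hx h.1 h.2
  refine LinearMap.finrank_le_finrank_of_injective
    (f := LinearMap.codRestrict (LinearMap.ker M.mulVecLin)
      ((Submodule.subtype _).comp (Submodule.subtype _)) this) ?_
  intro a b hab
  have := congrArg (fun t : LinearMap.ker M.mulVecLin => (t : V → ℂ)) hab
  exact Subtype.ext (Subtype.ext this)

/-- The kernel of `kerCoord M u` embeds in that of `M` and its target is two-dimensional, so the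
nullity of `M.zeroAt u` exceeds that of `M` by at most 2. -/
lemma rank_le_rank_zeroAt_add_two (M : Matrix V V ℂ) (u : V) :
    M.rank ≤ (M.zeroAt u).rank + 2 := by
  have h1 := rank_add_finrank_ker M
  have h2 := rank_add_finrank_ker (M.zeroAt u)
  have h3 := LinearMap.finrank_range_add_finrank_ker (kerCoord M u)
  have h4 := finrank_ker_kerCoord_le M u
  have h5 : Module.finrank ℂ (LinearMap.range (kerCoord M u)) ≤ 2 := by
    have := Submodule.finrank_le (LinearMap.range (kerCoord M u))
    simpa using this
  omega

omit [DecidableEq V] in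
lemma star_dotProduct_mulVec_comm {M : Matrix V V ℂ} (hM : M.IsHermitian) (x y : V → ℂ) :
    star x ⬝ᵥ (M *ᵥ y) = star (M *ᵥ x) ⬝ᵥ y := by
  rw [dotProduct_mulVec, star_mulVec, hM.eq]

/-- The hypotheses on `y` make `M *ᵥ y` a nonzero multiple of the basis vector at `u`, and the range
of a Hermitian matrix is orthogonal to its kernel. -/
lemma apply_eq_zero_of_mulVec {M : Matrix V V ℂ} (hM : M.IsHermitian) {u : V} {y x : V → ℂ}
    (hy : M.zeroAt u *ᵥ y = 0) (hyu : y u = 0) (hy' : (M *ᵥ y) u ≠ 0) (hx : M *ᵥ x = 0) :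
    x u = 0 := by
  have hMy : M *ᵥ y = Pi.single u ((M *ᵥ y) u) := by
    ext w
    by_cases hw : w = u
    · subst hw; simp
    · rw [mulVec_eq_zeroAt_mulVec_add M hw, hy, hyu]; simp [hw]
  have h := star_dotProduct_mulVec_comm hM x y
  rw [hx, hMy] at h
  simpa [hy'] using h

/-- Here `kerCoord M u` is onto and its kernel contains all of `ker M`. The next lemma is the
converse: such a `y` certifies exactly a drop of 2. -/
lemma rank_eq_rank_zeroAt_add_two {M : Matrix V V ℂ} (hM : M.IsHermitian) {u : V} {y : V → ℂ}
    (hy : M.zeroAt u *ᵥ y = 0) (hyu : y u = 0) (hy' : (M *ᵥ y) u ≠ 0) :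
    M.rank = (M.zeroAt u).rank + 2 := by
  refine le_antisymm (rank_le_rank_zeroAt_add_two M u) ?_
  have h1 := rank_add_finrank_ker M
  have h2 := rank_add_finrank_ker (M.zeroAt u)
  have h3 := LinearMap.finrank_range_add_finrank_ker (kerCoord M u)
  have hsurj : Function.Surjective (kerCoord M u) := by
    rintro ⟨α, β⟩
    let e : LinearMap.ker (M.zeroAt u).mulVecLin := ⟨Pi.single u 1, zeroAt_mulVec_single M u⟩
    let f : LinearMap.ker (M.zeroAt u).mulVecLin := ⟨y, hy⟩
    -- The images of `e` and `f` are `(1, M u u)` and `(0, (M *ᵥ y) u)`; the coefficients solve this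
    -- triangular system.
    refine ⟨α • e + ((β - α * M u u) / (M *ᵥ y) u) • f, ?_⟩
    rw [map_add, map_smul, map_smul, kerCoord_apply, kerCoord_apply]
    simp only [e, f]
    ext
    · simp [hyu]
    · simp only [Pi.single_eq_same, mulVec_single_one, Matrix.col_apply, Prod.smul_mk,
        smul_eq_mul, mul_one, Prod.mk_add_mk]
      field_simp
      ring
  have h5 : Module.finrank ℂ (LinearMap.range (kerCoord M u)) = 2 := by
    rw [LinearMap.range_eq_top.2 hsurj]; simp
  have h6 : Module.finrank ℂ (LinearMap.ker M.mulVecLin) ≤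
      Module.finrank ℂ (LinearMap.ker (kerCoord M u)) := by
    have h7 : ∀ x ∈ LinearMap.ker M.mulVecLin, x ∈ LinearMap.ker (M.zeroAt u).mulVecLin :=
      fun x hx => zeroAt_mulVec_eq_zero M hx (apply_eq_zero_of_mulVec hM hy hyu hy' hx)
    have h8 : ∀ x : LinearMap.ker M.mulVecLin,
        Submodule.inclusion h7 x ∈ LinearMap.ker (kerCoord M u) := by
      rintro ⟨x, hx⟩
      rw [LinearMap.mem_ker, kerCoord_apply, Prod.mk_eq_zero]
      refine ⟨apply_eq_zero_of_mulVec hM hy hyu hy' hx, ?_⟩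
      have : M *ᵥ x = 0 := hx
      simp [this]
    refine LinearMap.finrank_le_finrank_of_injective
      (f := LinearMap.codRestrict _ (Submodule.inclusion h7) h8) ?_
    intro a b hab
    have := congrArg (fun t : LinearMap.ker (kerCoord M u) =>
        ((t : LinearMap.ker (M.zeroAt u).mulVecLin) : V → ℂ)) hab
    exact Subtype.ext this
  omega

lemma exists_of_rank_eq_rank_zeroAt_add_two {M : Matrix V V ℂ} {u : V}
    (h : M.rank = (M.zeroAt u).rank + 2) :
    ∃ y : V → ℂ, M.zeroAt u *ᵥ y = 0 ∧ y u = 0 ∧ (M *ᵥ y) u ≠ 0 := by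
  have h1 := rank_add_finrank_ker M
  have h2 := rank_add_finrank_ker (M.zeroAt u)
  have h3 := LinearMap.finrank_range_add_finrank_ker (kerCoord M u)
  have h4 := finrank_ker_kerCoord_le M u
  have h5 : LinearMap.range (kerCoord M u) = ⊤ := by
    apply Submodule.eq_top_of_finrank_eq
    have := Submodule.finrank_le (LinearMap.range (kerCoord M u))
    simp only [Module.finrank_prod, Module.finrank_self] at this ⊢
    omega
  obtain ⟨⟨y, hy⟩, hyy⟩ := LinearMap.range_eq_top.1 h5 (0, 1)
  rw [kerCoord_apply, Prod.mk.injEq] at hyy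
  exact ⟨y, hy, hyy.1, by simp [hyy.2]⟩

/-- If every kernel vector vanished at `u`, then `ker M` would lie in `ker (M.zeroAt u)`, and equal
dimensions would put the basis vector at `u` into `ker M`. -/
lemma exists_of_rank_eq_rank_zeroAt {M : Matrix V V ℂ} {u : V}
    (h : M.rank = (M.zeroAt u).rank) : ∃ z : V → ℂ, M *ᵥ z = 0 ∧ z u ≠ 0 := by
  by_contra! hcon
  have h1 := rank_add_finrank_ker M
  have h2 := rank_add_finrank_ker (M.zeroAt u)
  have hle : LinearMap.ker M.mulVecLin ≤ LinearMap.ker (M.zeroAt u).mulVecLin :=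
    fun x hx => zeroAt_mulVec_eq_zero M hx (hcon x hx)
  have heq := Submodule.eq_of_le_of_finrank_eq hle (by omega)
  have hmem : (Pi.single u 1 : V → ℂ) ∈ LinearMap.ker M.mulVecLin := by
    rw [heq]; exact zeroAt_mulVec_single M u
  simpa using hcon _ hmem

lemma rank_eq_rank_zeroAt {M : Matrix V V ℂ} (hM : M.IsHermitian) {u : V} {z : V → ℂ}
    (hz : M *ᵥ z = 0) (hzu : z u ≠ 0) : M.rank = (M.zeroAt u).rank := by
  refine le_antisymm ?_ (rank_zeroAt_le M u)
  have h1 := rank_add_finrank_ker M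
  have h2 := rank_add_finrank_ker (M.zeroAt u)
  -- subtracting a multiple of `z` maps the kernel of `M.zeroAt u` to that of `M`
  have key : ∀ x : LinearMap.ker (M.zeroAt u).mulVecLin,
      M *ᵥ (x : V → ℂ) = ((x : V → ℂ) u) • (M *ᵥ Pi.single u 1) := by
    rintro ⟨x, hx⟩
    set x' : V → ℂ := x - (x u) • Pi.single u 1 with hx'
    have hx'u : x' u = 0 := by simp [hx']
    have hx'0 : M.zeroAt u *ᵥ x' = 0 := by
      have : M.zeroAt u *ᵥ x = 0 := hx
      rw [hx', mulVec_sub, mulVec_smul, zeroAt_mulVec_single, this]; simp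
    have : M *ᵥ x' = 0 := by
      apply mulVec_eq_zero_of_kerCoord M hx'0 hx'u
      by_contra hne
      exact hzu (apply_eq_zero_of_mulVec hM hx'0 hx'u hne hz)
    rw [hx', mulVec_sub, mulVec_smul, sub_eq_zero] at this
    exact this
  have hle : Module.finrank ℂ (LinearMap.ker (M.zeroAt u).mulVecLin) ≤
      Module.finrank ℂ (LinearMap.ker M.mulVecLin) := by
    -- The correction `x ↦ x + x u • w` cancels `M *ᵥ x = x u • (M *ᵥ Pi.single u 1)`; since `w u =
    -- 0`, it keeps the coordinate at `u` and is therefore injective.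
    let w : V → ℂ := (z u)⁻¹ • z - Pi.single u 1
    have hw : M *ᵥ w = - (M *ᵥ Pi.single u 1) := by
      simp [w, mulVec_sub, mulVec_smul, hz]
    have hwu : w u = 0 := by simp [w, hzu]
    let f : (V → ℂ) →ₗ[ℂ] (V → ℂ) := LinearMap.id + (LinearMap.proj u).smulRight w
    have hf : ∀ x : LinearMap.ker (M.zeroAt u).mulVecLin,
        (f.comp (Submodule.subtype _)) x ∈ LinearMap.ker M.mulVecLin := by
      intro x
      have := key x
      simp only [f, LinearMap.mem_ker, LinearMap.comp_apply, Submodule.subtype_apply,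
        LinearMap.add_apply, LinearMap.id_apply, LinearMap.smulRight_apply, LinearMap.proj_apply,
        mulVecLin_apply, mulVec_add, mulVec_smul, hw, this]
      simp
    refine LinearMap.finrank_le_finrank_of_injective (f := LinearMap.codRestrict _ _ hf) ?_
    rw [← LinearMap.ker_eq_bot, LinearMap.ker_eq_bot']
    rintro ⟨x, hx⟩ h0
    have h0' : x + x u • w = 0 := congrArg Subtype.val h0
    have hxu : x u = 0 := by simpa [hwu] using congrFun h0' u
    rw [hxu, zero_smul, add_zero] at h0'
    exact Subtype.ext h0'
  omega

end ZeroAt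

end Matrix

/-! ### Masked graphs and periodic parametrisations of cycles. -/

namespace SimpleGraph

variable {V : Type*}

/-- The graph on the same vertices keeping the edges of `G` inside `S`. -/
def mask (G : SimpleGraph V) (S : Set V) : SimpleGraph V where
  Adj a b := G.Adj a b ∧ a ∈ S ∧ b ∈ S
  symm := ⟨fun _ _ h => ⟨h.1.symm, h.2.2, h.2.1⟩⟩
  loopless := ⟨fun a h => G.loopless.irrefl a h.1⟩

lemma mask_adj {G : SimpleGraph V} {S : Set V} {a b : V} :
    (G.mask S).Adj a b ↔ G.Adj a b ∧ a ∈ S ∧ b ∈ S := Iff.rfl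

lemma mask_univ (G : SimpleGraph V) : G.mask Set.univ = G := by
  ext a b; simp [mask_adj]

lemma mask_mono (G : SimpleGraph V) {S T : Set V} (h : S ⊆ T) : G.mask S ≤ G.mask T :=
  fun _ _ hab => ⟨hab.1, h hab.2.1, h hab.2.2⟩

lemma mask_diff_singleton (G : SimpleGraph V) (S : Set V) (u : V) :
    G.mask (S \ {u}) = (G.mask S).deleteIncidenceSet u := by
  ext a b
  simp only [mask_adj, deleteIncidenceSet_adj, Set.mem_sdiff, Set.mem_singleton_iff]
  tauto

/-- `c` runs around a cycle of length `p` of `H`. -/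
structure IsCyc (H : SimpleGraph V) (p : ℕ) (c : ℕ → V) : Prop where
  three_le : 3 ≤ p
  adj : ∀ i, H.Adj (c i) (c (i + 1))
  eq_iff : ∀ i j, c i = c j ↔ i ≡ j [MOD p]

namespace IsCyc

variable {H : SimpleGraph V} {p : ℕ} {c : ℕ → V}

lemma add_period (h : H.IsCyc p c) (i : ℕ) : c (i + p) = c i :=
  (h.eq_iff _ _).2 (by simp [Nat.ModEq])

/-- Lets results about the base vertex `c 0` be applied at any vertex of the cycle. -/
lemma shift (h : H.IsCyc p c) (k : ℕ) : H.IsCyc p (fun i => c (i + k)) where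
  three_le := h.three_le
  adj i := by have := h.adj (i + k); rwa [show i + k + 1 = i + 1 + k by ring] at this
  eq_iff i j := by
    rw [h.eq_iff]
    exact ⟨fun h => Nat.ModEq.add_right_cancel' k h, fun h => h.add_right k⟩

lemma mono {H' : SimpleGraph V} (h : H.IsCyc p c) (hH : ∀ i, H'.Adj (c i) (c (i + 1))) :
    H'.IsCyc p c := ⟨h.three_le, hH, h.eq_iff⟩

lemma exists_lt_of_mem_range (h : H.IsCyc p c) {v : V} (hv : v ∈ Set.range c) :
    ∃ i < p, c i = v := by
  obtain ⟨i, rfl⟩ := hv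
  exact ⟨i % p, Nat.mod_lt _ (by have := h.three_le; omega),
    (h.eq_iff _ _).2 (Nat.mod_modEq _ _)⟩

lemma eq_of_lt (h : H.IsCyc p c) {i j : ℕ} (hi : i < p) (hj : j < p) (hij : c i = c j) : i = j :=
  ((h.eq_iff i j).1 hij).eq_of_lt_of_lt hi hj

lemma adj_pred (h : H.IsCyc p c) (i : ℕ) : H.Adj (c (i + (p - 1))) (c i) := by
  have := h.adj (i + (p - 1))
  rwa [show i + (p - 1) + 1 = i + p by have := h.three_le; omega, h.add_period] at this

lemma pred_ne_succ (h : H.IsCyc p c) : c (p - 1) ≠ c 1 := fun hc => by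
  have := h.three_le
  have := h.eq_of_lt (by omega) (by omega) hc
  omega

lemma reachable_delete (h : H.IsCyc p c) :
    (H.deleteIncidenceSet (c 0)).Reachable (c 1) (c (p - 1)) := by
  have h3 := h.three_le
  have : ∀ k, k + 1 < p → (H.deleteIncidenceSet (c 0)).Reachable (c 1) (c (k + 1)) := by
    intro k
    induction k with
    | zero => intro _; exact Reachable.refl _
    | succ k ih =>
      intro hk
      refine (ih (by omega)).trans (Adj.reachable ?_)
      rw [deleteIncidenceSet_adj]
      refine ⟨h.adj _, fun hc => ?_, fun hc => ?_⟩
      · have := h.eq_of_lt (by omega) (by omega) hc; omega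
      · have := h.eq_of_lt (by omega) (by omega) hc; omega
  have := this (p - 2) (by omega)
  rwa [show p - 2 + 1 = p - 1 by omega] at this

end IsCyc

lemma Walk.IsCycle.isCyc {H : SimpleGraph V} {u : V} {w : H.Walk u u} (hw : w.IsCycle) :
    H.IsCyc w.length (fun i => w.getVert (i % w.length)) := by
  have h3 := hw.three_le_length
  have hlast : ∀ i, w.getVert ((i + 1) % w.length) = w.getVert (i % w.length + 1) := by
    intro i
    have hlt : i % w.length < w.length := Nat.mod_lt _ (by omega)
    rw [Nat.add_mod, Nat.mod_eq_of_lt (show 1 < w.length by omega)]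
    rcases Nat.lt_or_ge (i % w.length + 1) w.length with h | h
    · rw [Nat.mod_eq_of_lt h]
    · rw [show i % w.length + 1 = w.length by omega, Nat.mod_self, Walk.getVert_zero,
        Walk.getVert_length]
  refine ⟨h3, fun i => ?_, fun i j => ⟨fun h => ?_, fun h => ?_⟩⟩
  · rw [hlast]
    exact w.adj_getVert_succ (Nat.mod_lt _ (by omega))
  · have hi : i % w.length < w.length := Nat.mod_lt _ (by omega)
    have hj : j % w.length < w.length := Nat.mod_lt _ (by omega)
    exact hw.getVert_injOn' (by simp only [Set.mem_ofPred_eq]; omega)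
      (by simp only [Set.mem_ofPred_eq]; omega) h
  · show w.getVert (i % w.length) = w.getVert (j % w.length)
    rw [h]

lemma exists_isCyc_of_not_isAcyclic {H : SimpleGraph V} (h : ¬ H.IsAcyclic) :
    ∃ p c, H.IsCyc p c := by
  simp only [IsAcyclic, not_forall, not_not] at h
  obtain ⟨u, w, hw⟩ := h
  exact ⟨_, _, hw.isCyc⟩

/-! ### Effect of deleting a vertex on the dimension of the cycle space. -/

section Delete

variable (H : SimpleGraph V) {u : V}

lemma reachable_delete_or {R : Set V}
    (hR : ∀ n, H.Adj u n → ∃ r ∈ R, (H.deleteIncidenceSet u).Reachable n r) {a : V}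
    (w : H.Walk a u) : (H.deleteIncidenceSet u).Reachable a u ∨
      ∃ r ∈ R, (H.deleteIncidenceSet u).Reachable a r := by
  induction w with
  | nil => exact Or.inl (Reachable.refl _)
  | @cons a b u hab w ih =>
    by_cases ha : a = u
    · subst ha; exact Or.inl (Reachable.refl _)
    by_cases hb : b = u
    · subst hb; exact Or.inr (hR a hab.symm)
    have hadj : (H.deleteIncidenceSet u).Adj a b := deleteIncidenceSet_adj.2 ⟨hab, ha, hb⟩
    rcases ih hR with h | ⟨r, hr, h⟩
    · exact Or.inl (hadj.reachable.trans h)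
    · exact Or.inr ⟨r, hr, hadj.reachable.trans h⟩

lemma reachable_delete_of_not_reachable {a b : V} (w : H.Walk a b) (h : ¬ H.Reachable a u) :
    (H.deleteIncidenceSet u).Reachable a b := by
  induction w with
  | nil => exact Reachable.refl _
  | @cons a b c hab w ih =>
    have hb : ¬ H.Reachable b u := fun hb => h (hab.reachable.trans hb)
    have hadj : (H.deleteIncidenceSet u).Adj a b := deleteIncidenceSet_adj.2
      ⟨hab, fun e => h (e ▸ Reachable.refl _), fun e => hb (e ▸ Reachable.refl _)⟩
    exact hadj.reachable.trans (ih hb)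

variable [Fintype V]

/-- After the deletion `u` remains as an isolated vertex, which takes over the old component of `u`;
the pieces of that component are hit by `R`, and all other components survive. -/
lemma card_connectedComponent_delete_le {R : Set V}
    (hR : ∀ n, H.Adj u n → ∃ r ∈ R, (H.deleteIncidenceSet u).Reachable n r) :
    Nat.card (H.deleteIncidenceSet u).ConnectedComponent ≤
      Nat.card H.ConnectedComponent + R.ncard := by
  classical
  let f : H.ConnectedComponent ⊕ R → (H.deleteIncidenceSet u).ConnectedComponent
    | Sum.inl C => if C = H.connectedComponentMk u then connectedComponentMk _ u else
        connectedComponentMk _ C.out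
    | Sum.inr r => connectedComponentMk _ (r : V)
  have hf : Function.Surjective f := by
    intro C
    induction C using ConnectedComponent.ind with | _ a =>
    by_cases ha : H.Reachable a u
    · obtain ⟨w⟩ := ha
      rcases reachable_delete_or H hR w with h | ⟨r, hr, h⟩
      · refine ⟨Sum.inl (H.connectedComponentMk u), ?_⟩
        simp only [f, if_true]
        exact ConnectedComponent.sound h.symm
      · exact ⟨Sum.inr ⟨r, hr⟩, ConnectedComponent.sound h.symm⟩
    · refine ⟨Sum.inl (H.connectedComponentMk a), ?_⟩
      have hne : H.connectedComponentMk a ≠ H.connectedComponentMk u :=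
        fun h => ha (ConnectedComponent.exact h)
      simp only [f, if_neg hne]
      have : H.Reachable a (H.connectedComponentMk a).out :=
        (ConnectedComponent.exact (Quot.out_eq (H.connectedComponentMk a))).symm
      obtain ⟨w⟩ := this
      exact ConnectedComponent.sound (reachable_delete_of_not_reachable H w ha).symm
  have := Nat.card_le_card_of_surjective f hf
  rwa [Nat.card_sum] at this

lemma card_connectedComponent_lt_delete {n : V} (hn : H.Adj u n) :
    Nat.card H.ConnectedComponent + 1 ≤ Nat.card (H.deleteIncidenceSet u).ConnectedComponent := by
  classical
  let f := ConnectedComponent.map (Hom.ofLE (H.deleteIncidenceSet_le u))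
  have hs : Function.Surjective f := by
    intro C
    induction C using ConnectedComponent.ind with | _ a =>
    exact ⟨connectedComponentMk _ a, rfl⟩
  have hni : ¬ Function.Injective f := by
    intro hi
    have : f (connectedComponentMk _ u) = f (connectedComponentMk _ n) :=
      ConnectedComponent.sound hn.reachable
    obtain ⟨w⟩ := ConnectedComponent.exact (hi this)
    cases w with
    | nil => exact H.loopless.irrefl _ hn
    | cons h _ => exact (deleteIncidenceSet_adj.1 h).2.1 rfl
  have := Fintype.ofFinite H.ConnectedComponent
  have := Fintype.ofFinite (H.deleteIncidenceSet u).ConnectedComponent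
  rw [Nat.card_eq_fintype_card, Nat.card_eq_fintype_card]
  exact Fintype.card_lt_of_surjective_not_injective f hs hni

lemma card_edgeSet_delete :
    Nat.card (H.deleteIncidenceSet u).edgeSet + (H.neighborSet u).ncard = Nat.card H.edgeSet := by
  classical
  have h := H.card_edgeFinset_deleteIncidenceSet u
  have h1 : (H.neighborSet u).ncard = H.degree u := by
    rw [Set.ncard_eq_toFinset_card']; rfl
  rw [h1, Nat.card_eq_fintype_card, Nat.card_eq_fintype_card, ← edgeFinset_card,
    ← edgeFinset_card]
  have := H.degree_le_card_edgeFinset u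
  rw [edgeFinset_card] at *
  rw [edgeFinset_card] at *
  omega

/-- The deletion loses one edge per neighbour, while the neighbours outside `D` already represent
all new components, so the edges to `D` are a net loss. -/
lemma cycleDim_delete_add_le {D : Set V} (hD : D ⊆ H.neighborSet u)
    (h : ∀ n ∈ D, ∃ r ∈ H.neighborSet u \ D, (H.deleteIncidenceSet u).Reachable n r) :
    cycleDim (H.deleteIncidenceSet u) + D.ncard ≤ cycleDim H := by
  have h1 := card_connectedComponent_delete_le H (u := u) (R := H.neighborSet u \ D) (by
    intro n hn
    by_cases hnD : n ∈ D
    · exact h n hnD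
    · exact ⟨n, ⟨hn, hnD⟩, Reachable.refl _⟩)
  have h2 := card_edgeSet_delete H (u := u)
  have h3 := Set.ncard_sdiff_add_ncard_of_subset hD
  unfold cycleDim
  omega

lemma cycleDim_delete_le : cycleDim (H.deleteIncidenceSet u) ≤ cycleDim H := by
  simpa using cycleDim_delete_add_le H (u := u) (D := ∅) (by simp) (by simp)

/-- If `u` has a neighbour, its isolation creates at least one component, which offsets one lost
edge. The truncated subtraction covers isolated `u`, where nothing changes. -/
lemma cycleDim_le_delete : cycleDim H ≤ cycleDim (H.deleteIncidenceSet u) +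
    ((H.neighborSet u).ncard - 1 : ℕ) := by
  have h2 := card_edgeSet_delete H (u := u)
  rcases Set.eq_empty_or_nonempty (H.neighborSet u) with h | ⟨n, hn⟩
  · have : H.deleteIncidenceSet u = H := by
      ext a b
      rw [deleteIncidenceSet_adj]
      refine ⟨fun h => h.1, fun hab => ⟨hab, ?_, ?_⟩⟩
      · rintro rfl
        exact (h ▸ (show b ∈ H.neighborSet a from hab) : b ∈ (∅ : Set V))
      · rintro rfl
        exact (h ▸ (show a ∈ H.neighborSet b from hab.symm) : a ∈ (∅ : Set V))
    rw [this]; simp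
  · have h1 := card_connectedComponent_lt_delete H hn
    have : 0 < (H.neighborSet u).ncard := (Set.ncard_pos (Set.toFinite _)).2 ⟨n, hn⟩
    unfold cycleDim
    omega

variable {H}

lemma IsCyc.cycleDim_delete_lt {p : ℕ} {c : ℕ → V} (h : H.IsCyc p c) :
    cycleDim (H.deleteIncidenceSet (c 0)) + 1 ≤ cycleDim H := by
  have := cycleDim_delete_add_le H (u := c 0) (D := {c 1})
    (by simpa using h.adj 0)
    (by
      rintro n rfl
      refine ⟨c (p - 1), ⟨?_, h.pred_ne_succ⟩, h.reachable_delete⟩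
      simpa using (h.adj_pred 0).symm)
  simpa using this

/-- If two cycles leave a common vertex through three different edges, then deleting that vertex
lowers the dimension of the cycle space by at least two. -/
lemma IsCyc.cycleDim_delete_add_two_le {p q : ℕ} {c d : ℕ → V} (hc : H.IsCyc p c)
    (hd : H.IsCyc q d) (h0 : c 0 = d 0) (h1 : d 1 ≠ c 1) (h2 : d 1 ≠ c (p - 1)) :
    cycleDim (H.deleteIncidenceSet (c 0)) + 2 ≤ cycleDim H := by
  have hrc := hc.reachable_delete
  have hrd := hd.reachable_delete
  rw [← h0] at hrd
  have hc1 : H.Adj (c 0) (c (p - 1)) := by simpa using (hc.adj_pred 0).symm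
  have hd1 : H.Adj (c 0) (d (q - 1)) := by simpa [h0] using (hd.adj_pred 0).symm
  have := cycleDim_delete_add_le H (u := c 0) (D := {d 1, c 1})
    (by
      rintro n (rfl | rfl)
      · simpa [h0] using hd.adj 0
      · simpa using hc.adj 0)
    (by
      have hcmem : c (p - 1) ∈ H.neighborSet (c 0) \ {d 1, c 1} := by
        refine ⟨hc1, ?_⟩
        rintro (h | h)
        · exact h2 h.symm
        · exact hc.pred_ne_succ h
      rintro n (rfl | rfl)
      -- The second cycle links `d 1` to `d (q - 1)`. If that vertex is the excluded `c 1`, the link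
      -- is continued along the first cycle to `c (p - 1)`.
      · by_cases hdc : d (q - 1) = c 1
        · exact ⟨c (p - 1), hcmem, (hdc ▸ hrd).trans hrc⟩
        · refine ⟨d (q - 1), ⟨hd1, ?_⟩, hrd⟩
          rintro (h | h)
          · exact hd.pred_ne_succ h
          · exact hdc h
      · exact ⟨c (p - 1), hcmem, hrc⟩)
  rwa [Set.ncard_pair h1] at this

/-- A finite acyclic graph with an edge has a pendant vertex. -/
lemma IsAcyclic.exists_ncard_neighborSet_eq_one (h : H.IsAcyclic) {a b : V} (hab : H.Adj a b) :
    ∃ v, (H.neighborSet v).ncard = 1 := by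
  classical
  let C := H.connectedComponentMk a
  have hT := h.isTree_connectedComponent C
  have ha : a ∈ C.supp := rfl
  have hb : b ∈ C.supp := ConnectedComponent.sound hab.symm.reachable
  have : Nontrivial C := ⟨⟨a, ha⟩, ⟨b, hb⟩, fun e => hab.ne (congrArg Subtype.val e)⟩
  obtain ⟨v, hv⟩ := hT.exists_vert_degree_one_of_nontrivial
  refine ⟨v, ?_⟩
  rw [degree_eq_one_iff_existsUnique_adj] at hv
  obtain ⟨w, hw, hu⟩ := hv
  rw [Set.ncard_eq_one]
  refine ⟨w, ?_⟩
  ext x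
  simp only [mem_neighborSet, Set.mem_singleton_iff]
  constructor
  · intro hx
    have hxC : x ∈ C.supp := by
      have := v.2
      exact C.mem_supp_of_adj_mem_supp this hx
    exact congrArg Subtype.val (hu ⟨x, hxC⟩ hx)
  · rintro rfl; exact hw

lemma cycleDim_bot : cycleDim (⊥ : SimpleGraph V) = 0 := by
  have h : Nat.card V = Nat.card (⊥ : SimpleGraph V).ConnectedComponent := by
    refine Nat.card_congr (Equiv.ofBijective (fun v => connectedComponentMk ⊥ v) ⟨?_, ?_⟩)
    · intro a b hab
      obtain ⟨w⟩ := ConnectedComponent.exact hab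
      cases w with
      | nil => rfl
      | cons h _ => exact absurd h (by simp)
    · intro C
      induction C using ConnectedComponent.ind with | _ a => exact ⟨a, rfl⟩
  unfold cycleDim
  rw [← h]
  simp

lemma IsAcyclic.cycleDim_le : ∀ {H : SimpleGraph V}, H.IsAcyclic → cycleDim H ≤ 0 := by
  intro H
  induction hn : Nat.card H.edgeSet using Nat.strong_induction_on generalizing H with
  | _ n ih =>
    intro h
    by_cases hE : ∃ a b, H.Adj a b
    · obtain ⟨a, b, hab⟩ := hE
      obtain ⟨v, hv⟩ := h.exists_ncard_neighborSet_eq_one hab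
      have h1 := cycleDim_le_delete H (u := v)
      have h2 := card_edgeSet_delete H (u := v)
      have h3 := ih _ (by omega) rfl (h.anti (H.deleteIncidenceSet_le v))
      rw [hv] at h1
      simpa using h1.trans (add_le_add_left h3 _)
    · push Not at hE
      have : H = ⊥ := by ext a b; simp [hE]
      rw [this, cycleDim_bot]

lemma sum_ncard_neighborSet :
    ∑ v, (H.neighborSet v).ncard = 2 * Nat.card H.edgeSet := by
  classical
  rw [Nat.card_eq_fintype_card, ← edgeFinset_card, ← H.sum_degrees_eq_twice_card_edges]
  refine Finset.sum_congr rfl fun v _ => ?_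
  rw [Set.ncard_eq_toFinset_card']; rfl

end Delete

end SimpleGraph

/-! ### Weightings on masks and the rank inequality. -/

open Classical in
/-- The matrix obtained from `M` by replacing all entries outside `S × S` by zero. -/
noncomputable def Matrix.maskMat {V R : Type*} [Zero R] (M : Matrix V V R) (S : Set V) :
    Matrix V V R :=
  Matrix.of fun a b => if a ∈ S ∧ b ∈ S then M a b else 0

/-- A Hermitian matrix whose nonzero entries are exactly at the edges of `G`. -/
structure SimpleGraph.IsWeighting {V : Type*} (G : SimpleGraph V) (M : Matrix V V ℂ) : Prop where
  isHermitian : M.IsHermitian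
  ne_zero_iff : ∀ a b, M a b ≠ 0 ↔ G.Adj a b

namespace SimpleGraph

variable {V : Type*}

section Mask

variable {G : SimpleGraph V} {M : Matrix V V ℂ}

lemma IsWeighting.mask (hM : G.IsWeighting M) (S : Set V) :
    (G.mask S).IsWeighting (M.maskMat S) where
  isHermitian := by
    ext a b
    have := congrFun (congrFun hM.isHermitian a) b
    simp only [conjTranspose_apply, maskMat, of_apply] at this ⊢
    by_cases ha : a ∈ S <;> by_cases hb : b ∈ S <;> simp [ha, hb, this]
  ne_zero_iff a b := by
    classical
    simp only [maskMat, of_apply, mask_adj, ← hM.ne_zero_iff, ne_eq, ite_eq_right_iff,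
      Classical.not_imp]
    tauto

lemma IsWeighting.eq_zero (hM : G.IsWeighting M) {a b : V} (h : ¬ G.Adj a b) : M a b = 0 := by
  by_contra h'
  exact h ((hM.ne_zero_iff a b).1 h')

lemma mask_diff_of_isolated {S : Set V} {u : V} (h : ∀ x, ¬ (G.mask S).Adj u x) :
    G.mask (S \ {u}) = G.mask S := by
  ext a b
  simp only [mask_adj, Set.mem_sdiff, Set.mem_singleton_iff]
  refine ⟨fun h => ⟨h.1, h.2.1.1, h.2.2.1⟩, fun hab => ⟨hab.1, ⟨hab.2.1, ?_⟩, hab.2.2, ?_⟩⟩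
  · rintro rfl; exact h b hab
  · rintro rfl; exact h a (SimpleGraph.Adj.symm hab)

lemma IsWeighting.maskMat_diff_of_isolated (hM : G.IsWeighting M) {S : Set V} {u : V}
    (h : ∀ x, ¬ (G.mask S).Adj u x) : M.maskMat (S \ {u}) = M.maskMat S := by
  ext a b
  by_cases hab : (G.mask S).Adj a b
  · have h2 := mask_diff_of_isolated h ▸ hab
    simp [maskMat, hab.2, h2.2]
  · rw [(hM.mask S).eq_zero hab, (hM.mask _).eq_zero (by rwa [mask_diff_of_isolated h])]

variable [Fintype V]

lemma IsWeighting.mulVec_eq_zero (hM : G.IsWeighting M) {a : V} {x : V → ℂ}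
    (h : ∀ y, G.Adj a y → x y = 0) : (M *ᵥ x) a = 0 := by
  refine Finset.sum_eq_zero fun b _ => ?_
  by_cases hb : G.Adj a b
  · simp [h b hb]
  · simp [hM.eq_zero hb]

lemma IsWeighting.mulVec_eq_pair (hM : G.IsWeighting M) {a b c : V} {x : V → ℂ} (hbc : b ≠ c)
    (h : ∀ y, G.Adj a y → y ≠ b → y ≠ c → x y = 0) :
    (M *ᵥ x) a = M a b * x b + M a c * x c := by
  classical
  rw [mulVec, dotProduct, ← Finset.sum_pair (f := fun y => M a y * x y) hbc]
  symm
  refine Finset.sum_subset (Finset.subset_univ _) fun y _ hy => ?_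
  simp only [Finset.mem_insert, Finset.mem_singleton, not_or] at hy
  by_cases hb : G.Adj a y
  · rw [h y hb hy.1 hy.2, mul_zero]
  · rw [hM.eq_zero hb, zero_mul]

omit [Fintype V] in
lemma maskMat_zeroAt [DecidableEq V] (M : Matrix V V ℂ) (S : Set V) (u : V) :
    (M.maskMat S).zeroAt u = M.maskMat (S \ {u}) := by
  ext a b
  by_cases ha : a = u <;> by_cases hb : b = u <;> by_cases haS : a ∈ S <;>
    by_cases hbS : b ∈ S <;> simp [zeroAt, maskMat, ha, hb, haS, hbS]

omit [Fintype V] in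
lemma maskMat_univ (M : Matrix V V ℂ) : M.maskMat Set.univ = M := by
  ext a b; simp [maskMat]

/-- Deletion of a pendant vertex of the graph induced on `S`, with its neighbour. -/
def PendantStep (G : SimpleGraph V) (S T : Set V) : Prop :=
  ∃ u v, (G.mask S).neighborSet u = {v} ∧ T = S \ {u, v}

omit [Fintype V] in
lemma not_adj_of_neighborSet_eq_singleton {S : Set V} {u v : V}
    (h : (G.mask S).neighborSet u = {v}) (x : V) : ¬ (G.mask (S \ {v})).Adj u x := by
  intro hx
  have : x ∈ (G.mask S).neighborSet u := mask_mono G Set.sdiff_subset hx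
  rw [h] at this
  exact hx.2.2.2 this

omit [Fintype V] in
lemma diff_pair (S : Set V) (u v : V) : S \ {u, v} = (S \ {v}) \ {u} := by
  ext; simp; tauto

/-- The basis vector at `u` is mapped to a nonzero multiple of the one at `v`, so deleting `v` costs
rank 2; afterwards `u` is isolated and can be dropped freely. -/
lemma IsWeighting.rank_pendant (hM : G.IsWeighting M) {S : Set V} {u v : V}
    (h : (G.mask S).neighborSet u = {v}) :
    (M.maskMat S).rank = (M.maskMat (S \ {u, v})).rank + 2 := by
  classical
  have hi := not_adj_of_neighborSet_eq_singleton h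
  rw [diff_pair, hM.maskMat_diff_of_isolated hi, ← maskMat_zeroAt]
  have huv : (G.mask S).Adj u v := by
    rw [← mem_neighborSet, h]; rfl
  refine rank_eq_rank_zeroAt_add_two (hM.mask S).isHermitian (y := Pi.single u 1) ?_ ?_ ?_
  · rw [maskMat_zeroAt]
    ext a
    rw [mulVec_single_one]
    exact (hM.mask _).eq_zero fun ha => hi a ha.symm
  · rw [Pi.single_eq_of_ne huv.ne.symm]
  · rw [mulVec_single_one]
    exact ((hM.mask S).ne_zero_iff _ _).2 huv.symm

omit [Fintype V] in
lemma cycleDim_pendant_le {S : Set V} {u v : V} (h : (G.mask S).neighborSet u = {v}) :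
    cycleDim (G.mask (S \ {u, v})) ≤ cycleDim (G.mask (S \ {v})) := by
  rw [diff_pair, mask_diff_of_isolated (not_adj_of_neighborSet_eq_singleton h)]

lemma cycleDim_mask_diff_le (S : Set V) (v : V) :
    cycleDim (G.mask (S \ {v})) ≤ cycleDim (G.mask S) := by
  rw [mask_diff_singleton]; exact cycleDim_delete_le _

variable {N : Matrix V V ℂ}

omit [Fintype V] in
lemma IsCyc.mem {S : Set V} {p : ℕ} {c : ℕ → V} (h : (G.mask S).IsCyc p c) (i : ℕ) : c i ∈ S :=
  (h.adj i).2.1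

omit [Fintype V] in
lemma IsCyc.of_mask {S : Set V} {p : ℕ} {c : ℕ → V} (h : (G.mask S).IsCyc p c) : G.IsCyc p c :=
  h.mono fun i => (h.adj i).1

omit [Fintype V] in
lemma IsCyc.mask {S : Set V} {p : ℕ} {c : ℕ → V} (h : G.IsCyc p c) (hS : ∀ i, c i ∈ S) :
    (G.mask S).IsCyc p c :=
  h.mono fun i => ⟨h.adj i, hS _, hS _⟩

lemma IsCyc.cycleDim_mask_lt {S : Set V} {p : ℕ} {c : ℕ → V} (h : (G.mask S).IsCyc p c) (i : ℕ) :
    cycleDim (G.mask (S \ {c i})) + 1 ≤ cycleDim (G.mask S) := by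
  have := (h.shift i).cycleDim_delete_lt
  rwa [zero_add, ← mask_diff_singleton] at this

/-- The rank drops by at most twice the dimension of the cycle space between two weightings. -/
theorem IsWeighting.rank_sub_le (hM : G.IsWeighting M) (hN : G.IsWeighting N) (S : Set V) :
    ((N.maskMat S).rank : ℤ) - 2 * cycleDim (G.mask S) ≤ (M.maskMat S).rank := by
  classical
  induction hn : S.ncard using Nat.strong_induction_on generalizing S with
  | _ n ih =>
    subst hn
    by_cases hac : (G.mask S).IsAcyclic
    · by_cases hE : ∃ a b, (G.mask S).Adj a b
      · obtain ⟨a, b, hab⟩ := hE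
        obtain ⟨u, hu⟩ := hac.exists_ncard_neighborSet_eq_one hab
        obtain ⟨v, huv⟩ := Set.ncard_eq_one.1 hu
        have hadj : (G.mask S).Adj u v := by rw [← mem_neighborSet, huv]; rfl
        have h1 := hM.rank_pendant huv
        have h2 := hN.rank_pendant huv
        have h3 := cycleDim_pendant_le huv
        have h4 := cycleDim_mask_diff_le (G := G) S v
        have h5 := ih _ (Set.ncard_lt_ncard (t := S) (s := S \ {u, v})
          ⟨Set.sdiff_subset, fun h => (h hadj.2.1).2 (by simp)⟩) _ rfl
        omega
      · push Not at hE
        have h1 : N.maskMat S = 0 := by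
          ext a b; exact (hN.mask S).eq_zero (hE a b)
        have h2 : G.mask S = ⊥ := by ext a b; simp [hE]
        rw [h1, h2, cycleDim_bot]
        simp
    · obtain ⟨p, c, hc⟩ := exists_isCyc_of_not_isAcyclic hac
      have h1 := hc.cycleDim_mask_lt 0
      have h2 := rank_le_rank_zeroAt_add_two (N.maskMat S) (c 0)
      have h3 := rank_zeroAt_le (M.maskMat S) (c 0)
      rw [maskMat_zeroAt] at h2 h3
      have h5 := ih _ (Set.ncard_lt_ncard (t := S) (s := S \ {c 0})
          ⟨Set.sdiff_subset, fun h => (h (hc.mem 0)).2 (by simp)⟩) _ rfl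
      omega

/-- Equality in `IsWeighting.rank_sub_le`. -/
def LowerOptimal (G : SimpleGraph V) (M N : Matrix V V ℂ) (S : Set V) : Prop :=
  ((M.maskMat S).rank : ℤ) = (N.maskMat S).rank - 2 * cycleDim (G.mask S)

/-! ### Consequences of equality in the rank inequality. -/

section LowerOptimal

variable {S : Set V} (hM : G.IsWeighting M) (hN : G.IsWeighting N)

include hM hN

/-- The three estimates in the cycle step of `IsWeighting.rank_sub_le` add up to an equality, so
each of them is sharp. -/
lemma LowerOptimal.of_cycle (h : LowerOptimal G M N S) {p : ℕ} {c : ℕ → V}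
    (hc : (G.mask S).IsCyc p c) (i : ℕ) :
    LowerOptimal G M N (S \ {c i}) ∧ (M.maskMat S).rank = (M.maskMat (S \ {c i})).rank ∧
    (N.maskMat S).rank = (N.maskMat (S \ {c i})).rank + 2 ∧
    cycleDim (G.mask (S \ {c i})) + 1 = cycleDim (G.mask S) := by
  classical
  have h1 := hc.cycleDim_mask_lt i
  have h2 := rank_le_rank_zeroAt_add_two (N.maskMat S) (c i)
  have h3 := rank_zeroAt_le (M.maskMat S) (c i)
  rw [maskMat_zeroAt] at h2 h3
  have h4 := hM.rank_sub_le hN (S \ {c i})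
  unfold LowerOptimal at *
  omega

/-- Both ranks drop by 2, so `cycleDim` cannot drop; deleting a vertex of a cycle would make it
drop. -/
lemma LowerOptimal.of_pendant (h : LowerOptimal G M N S) {u v : V}
    (huv : (G.mask S).neighborSet u = {v}) :
    LowerOptimal G M N (S \ {u, v}) ∧
      cycleDim (G.mask (S \ {u, v})) = cycleDim (G.mask S) ∧
      ∀ p c, (G.mask S).IsCyc p c → v ∉ Set.range c := by
  have h1 := hM.rank_pendant huv
  have h2 := hN.rank_pendant huv
  have h3 := cycleDim_pendant_le huv
  have h4 := cycleDim_mask_diff_le (G := G) S v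
  have h5 := hM.rank_sub_le hN (S \ {u, v})
  unfold LowerOptimal at *
  refine ⟨by omega, by omega, ?_⟩
  rintro p c hc ⟨i, rfl⟩
  have := hc.cycleDim_mask_lt i
  omega

lemma LowerOptimal.of_steps {T : Set V} (h : LowerOptimal G M N S)
    (hST : Relation.ReflTransGen (PendantStep G) S T) : LowerOptimal G M N T := by
  induction hST with
  | refl => exact h
  | tail _ hs ih =>
    obtain ⟨u, v, huv, rfl⟩ := hs
    exact (ih.of_pendant hM hN huv).1

/-- Otherwise three edges of the two cycles leave the common vertex, and deleting it lowers
`cycleDim` by 2 rather than the exact 1 of `LowerOptimal.of_cycle`. -/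
lemma LowerOptimal.succ_eq (h : LowerOptimal G M N S) {p q : ℕ} {c d : ℕ → V}
    (hc : (G.mask S).IsCyc p c) (hd : (G.mask S).IsCyc q d) {i j : ℕ} (hij : c i = d j) :
    d (j + 1) = c (i + 1) ∨ d (j + 1) = c (i + (p - 1)) := by
  by_contra! hne
  have h1 := (hc.shift i).cycleDim_delete_add_two_le (hd.shift j) (by simpa using hij)
    (by simpa [add_comm] using hne.1) (by simpa [add_comm] using hne.2)
  have h2 := h.of_cycle hM hN hc i
  rw [zero_add, ← mask_diff_singleton] at h1
  omega

lemma LowerOptimal.edge_mem (h : LowerOptimal G M N S) {p q : ℕ} {c d : ℕ → V}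
    (hc : (G.mask S).IsCyc p c) (hd : (G.mask S).IsCyc q d) {i j : ℕ} (hij : c i = d j) (k : ℕ) :
    ∃ l, c l = d (j + k) ∧ (d (j + k + 1) = c (l + 1) ∨ d (j + k + 1) = c (l + (p - 1))) := by
  induction k with
  | zero => exact ⟨i, hij, h.succ_eq hM hN hc hd hij⟩
  | succ k ih =>
    obtain ⟨l, _, h2 | h2⟩ := ih
    · exact ⟨_, h2.symm, h.succ_eq hM hN hc hd h2.symm⟩
    · exact ⟨_, h2.symm, h.succ_eq hM hN hc hd h2.symm⟩

lemma LowerOptimal.range_subset (h : LowerOptimal G M N S) {p q : ℕ} {c d : ℕ → V}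
    (hc : (G.mask S).IsCyc p c) (hd : (G.mask S).IsCyc q d)
    (hcd : ¬ Disjoint (Set.range c) (Set.range d)) : Set.range d ⊆ Set.range c := by
  rw [Set.not_disjoint_iff] at hcd
  obtain ⟨_, ⟨i, rfl⟩, j, hj⟩ := hcd
  rintro _ ⟨k, rfl⟩
  -- `LowerOptimal.edge_mem` only moves forward from `j`; this number of steps ends at `k + j * q`,
  -- which is `k` modulo `q`.
  obtain ⟨l, hl, _⟩ := h.edge_mem hM hN hc hd hj.symm (k + j * (q - 1))
  refine ⟨l, hl.trans ?_⟩
  rw [hd.eq_iff]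
  have : j + (k + j * (q - 1)) = k + j * q := by
    have := hd.three_le
    obtain ⟨q', rfl⟩ : ∃ q', q = q' + 1 := ⟨q - 1, by omega⟩
    simp only [Nat.add_sub_cancel]; ring
  rw [this]
  simp [Nat.ModEq]

lemma LowerOptimal.range_eq (h : LowerOptimal G M N S) {p q : ℕ} {c d : ℕ → V}
    (hc : (G.mask S).IsCyc p c) (hd : (G.mask S).IsCyc q d)
    (hcd : ¬ Disjoint (Set.range c) (Set.range d)) : Set.range d = Set.range c :=
  (h.range_subset hM hN hc hd hcd).antisymm
    (h.range_subset hM hN hd hc fun h => hcd h.symm)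

end LowerOptimal

/-! ### Pendant steps along paths and cycles. -/

omit [Fintype V] in
-- Vertices are removed in consecutive pairs: once the earlier pairs are gone, `f (2 * i)` is
-- pendant with neighbour `f (2 * i + 1)`.
lemma steps_along (S : Set V) (f : ℕ → V) (k : ℕ)
    (hf : ∀ i < 2 * k, ∀ j < 2 * k, f i = f j → i = j)
    (hadj : ∀ i < k, (G.mask S).Adj (f (2 * i)) (f (2 * i + 1)))
    (hnbr : ∀ i < k, ∀ x, (G.mask S).Adj (f (2 * i)) x →
      x = f (2 * i + 1) ∨ ∃ j < 2 * i, x = f j) :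
    Relation.ReflTransGen (PendantStep G) S (S \ f '' {j | j < 2 * k}) := by
  induction k with
  | zero => simp [Relation.ReflTransGen.refl]
  | succ k ih =>
    refine (ih (fun i hi j hj => hf i (by omega) j (by omega)) (fun i hi => hadj i (by omega))
      (fun i hi => hnbr i (by omega))).tail ?_
    refine ⟨f (2 * k), f (2 * k + 1), ?_, ?_⟩
    · have hu : ∀ m, (m = 2 * k ∨ m = 2 * k + 1) → f m ∉ f '' {j | j < 2 * k} := by
        rintro m hm ⟨j, hj, hjm⟩
        simp only [Set.mem_ofPred_eq] at hj
        have := hf j (by omega) m (by omega) hjm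
        omega
      have ha := hadj k (by omega)
      ext x
      simp only [mem_neighborSet, Set.mem_singleton_iff]
      constructor
      · intro hx
        rcases hnbr k (by omega) x (mask_mono G Set.sdiff_subset hx) with h | ⟨j, hj, rfl⟩
        · exact h
        · exact absurd ⟨j, hj, rfl⟩ hx.2.2.2
      · rintro rfl
        exact ⟨ha.1, ⟨ha.2.1, hu _ (Or.inl rfl)⟩, ha.2.2, hu _ (Or.inr rfl)⟩
    · ext x
      simp only [Set.mem_sdiff, Set.mem_image, Set.mem_ofPred_eq, Set.mem_insert_iff,
        Set.mem_singleton_iff, not_exists, not_and, not_or]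
      constructor
      · rintro ⟨h1, h2⟩
        exact ⟨⟨h1, fun j hj => h2 j (by omega)⟩, fun h => h2 (2 * k) (by omega) h.symm,
          fun h => h2 (2 * k + 1) (by omega) h.symm⟩
      · rintro ⟨⟨h1, h2⟩, h3, h4⟩
        refine ⟨h1, fun j hj => ?_⟩
        rcases Nat.lt_or_ge j (2 * k) with h | h
        · exact h2 j h
        · obtain rfl | rfl : j = 2 * k ∨ j = 2 * k + 1 := by omega
          · exact fun h => h3 h.symm
          · exact fun h => h4 h.symm

variable {S : Set V}

omit [Fintype V] in
lemma IsCyc.ne_of_lt {H : SimpleGraph V} {p : ℕ} {c : ℕ → V} (hc : H.IsCyc p c) {i j : ℕ}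
    (hi : i < p) (hj : j < p) (hij : i ≠ j) : c i ≠ c j := fun h => hij (hc.eq_of_lt hi hj h)

omit [Fintype V] in
/-- On an even cycle with at most one vertex of degree more than two, pendant steps remove all of
the cycle but one isolated vertex once the exceptional vertex is deleted. -/
lemma IsCyc.steps_delete_zero {m : ℕ} {c : ℕ → V} (hc : (G.mask S).IsCyc (2 * m) c)
    (hdeg : ∀ i, 0 < i → i < 2 * m → ∀ x, (G.mask S).Adj (c i) x → x = c (i - 1) ∨ x = c (i + 1)) :
    ∃ T, Relation.ReflTransGen (PendantStep G) (S \ {c 0}) T ∧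
      (∀ x, ¬ (G.mask T).Adj (c (2 * m - 1)) x) ∧ T \ {c (2 * m - 1)} = S \ Set.range c := by
  have h3 := hc.three_le
  refine ⟨_, steps_along (S \ {c 0}) (fun i => c (i + 1)) (m - 1) ?_ ?_ ?_, ?_, ?_⟩
  · intro i hi j hj hij
    have := hc.eq_of_lt (by omega) (by omega) hij
    omega
  · intro i hi
    have ha := hc.adj (2 * i + 1)
    exact ⟨ha.1, ⟨ha.2.1, hc.ne_of_lt (by omega) (by omega) (by omega)⟩, ha.2.2,
      hc.ne_of_lt (by omega) (by omega) (by omega)⟩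
  · intro i hi x hx
    rcases hdeg (2 * i + 1) (by omega) (by omega) x (mask_mono G Set.sdiff_subset hx) with h | h
    · rcases Nat.eq_zero_or_pos i with rfl | hi0
      · exact absurd h hx.2.2.2
      · exact Or.inr ⟨2 * i - 1, by omega, by
          rw [h]; congr 1; omega⟩
    · exact Or.inl h
  · intro x hx
    have hx' := mask_mono G (Set.sdiff_subset.trans Set.sdiff_subset) hx
    rcases hdeg (2 * m - 1) (by omega) (by omega) x hx' with h | h
    · refine hx.2.2.2 ⟨2 * m - 3, ?_, ?_⟩
      · simp only [Set.mem_ofPred_eq]; omega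
      · rw [h]; simp only []; congr 1; omega
    · refine hx.2.2.1.2 ?_
      rw [h, Set.mem_singleton_iff]
      have := hc.add_period 0
      rwa [zero_add, show 2 * m = 2 * m - 1 + 1 by omega] at this
  · ext x
    simp only [Set.mem_sdiff, Set.mem_singleton_iff, Set.mem_image, Set.mem_ofPred_eq, not_exists,
      not_and]
    constructor
    · rintro ⟨⟨⟨h1, h2⟩, h4⟩, h5⟩
      refine ⟨h1, fun hx => ?_⟩
      obtain ⟨i, hi, rfl⟩ := hc.exists_lt_of_mem_range hx
      rcases Nat.eq_zero_or_pos i with rfl | hi0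
      · exact h2 rfl
      · by_cases hi1 : i = 2 * m - 1
        · subst hi1; exact h5 rfl
        · exact h4 (i - 1) (by omega) (by rw [Nat.sub_add_cancel hi0])
    · rintro ⟨h1, h2⟩
      refine ⟨⟨⟨h1, ?_⟩, ?_⟩, ?_⟩
      · rintro rfl; exact h2 ⟨_, rfl⟩
      · rintro j _ rfl; exact h2 ⟨_, rfl⟩
      · rintro rfl; exact h2 ⟨_, rfl⟩

omit [Fintype V] in
-- Without `c 1`, the vertices `c 2, …, c (2 * m - 1)` form a path starting at a pendant vertex and
-- are removed in pairs. Unlike `IsCyc.steps_delete_zero`, this keeps the exceptional vertex `c 0`.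
lemma IsCyc.steps_delete_one {m : ℕ} {c : ℕ → V} (hc : (G.mask S).IsCyc (2 * m) c)
    (hdeg : ∀ i, 0 < i → i < 2 * m → ∀ x, (G.mask S).Adj (c i) x → x = c (i - 1) ∨ x = c (i + 1)) :
    Relation.ReflTransGen (PendantStep G) (S \ {c 1}) (S \ (Set.range c \ {c 0})) := by
  have h3 := hc.three_le
  have key := steps_along (G := G) (S \ {c 1}) (fun i => c (i + 2)) (m - 1) ?_ ?_ ?_
  · convert key using 1
    ext x
    simp only [Set.mem_sdiff, Set.mem_singleton_iff, Set.mem_image, Set.mem_ofPred_eq, not_exists,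
      not_and, not_not]
    constructor
    · rintro ⟨h1, h2⟩
      refine ⟨⟨h1, ?_⟩, ?_⟩
      · rintro rfl
        exact hc.ne_of_lt (i := 1) (j := 0) (by omega) (by omega) (by omega) (h2 ⟨_, rfl⟩)
      · rintro j hj rfl
        exact hc.ne_of_lt (i := j + 2) (j := 0) (by omega) (by omega) (by omega) (h2 ⟨_, rfl⟩)
    · rintro ⟨⟨h1, h2⟩, h4⟩
      refine ⟨h1, fun hx => ?_⟩
      obtain ⟨i, hi, rfl⟩ := hc.exists_lt_of_mem_range hx
      by_contra hne
      have hi0 : i ≠ 0 := by rintro rfl; exact hne rfl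
      have hi1 : i ≠ 1 := by rintro rfl; exact h2 rfl
      exact h4 (i - 2) (by omega) (by congr 1; omega)
  · intro i hi j hj hij
    have := hc.eq_of_lt (by omega) (by omega) hij
    omega
  · intro i hi
    have ha := hc.adj (2 * i + 2)
    exact ⟨ha.1, ⟨ha.2.1, hc.ne_of_lt (by omega) (by omega) (by omega)⟩, ha.2.2,
      hc.ne_of_lt (by omega) (by omega) (by omega)⟩
  · intro i hi x hx
    rcases hdeg (2 * i + 2) (by omega) (by omega) x (mask_mono G Set.sdiff_subset hx) with h | h
    · rcases Nat.eq_zero_or_pos i with rfl | hi0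
      · exact absurd h hx.2.2.2
      · exact Or.inr ⟨2 * i - 1, by omega, by
          rw [h]; congr 1; omega⟩
    · exact Or.inl h

end Mask

end SimpleGraph

/-! ### What the rank conditions say about a cycle component. -/

namespace SimpleGraph

variable {V : Type*}

lemma Walk.IsCycle.range_getVert_mod {H : SimpleGraph V} {u : V} {w : H.Walk u u}
    (hw : w.IsCycle) : Set.range (fun i => w.getVert (i % w.length)) = {x | x ∈ w.support} := by
  have h3 := hw.three_le_length
  ext x
  simp only [Set.mem_range, Set.mem_ofPred_eq]
  constructor
  · rintro ⟨i, rfl⟩; exact w.getVert_mem_support _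
  · intro hx
    obtain ⟨n, hn, hnl⟩ := Walk.mem_support_iff_exists_getVert.1 hx
    rcases hnl.lt_or_eq with h | h
    · exact ⟨n, by rw [Nat.mod_eq_of_lt h, hn]⟩
    · refine ⟨0, ?_⟩
      rw [Nat.zero_mod, Walk.getVert_zero, ← hn, h, Walk.getVert_length]

lemma IsCycles.exists_isCyc [Finite V] {H : SimpleGraph V} (h : H.IsCycles) {v w : V}
    (hvw : H.Adj v w) :
    ∃ p c, H.IsCyc p c ∧ c 0 = v ∧ Set.range c = (H.connectedComponentMk v).supp := by
  obtain ⟨q, hq, hs⟩ := h.exists_cycle_toSubgraph_verts_eq_connectedComponentSupp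
    (c := H.connectedComponentMk v) (v := v) rfl ⟨w, hvw⟩
  refine ⟨_, _, hq.isCyc, by simp, ?_⟩
  rw [hq.range_getVert_mod, ← hs, Walk.verts_toSubgraph]

lemma IsCyc.eq_or_eq_of_ncard_eq_two {H : SimpleGraph V} {p : ℕ} {c : ℕ → V} (hc : H.IsCyc p c)
    {i : ℕ} (h2 : (H.neighborSet (c i)).ncard = 2) {x : V} (hx : H.Adj (c i) x) :
    x = c (i + 1) ∨ x = c (i + (p - 1)) := by
  have hne : c (i + 1) ≠ c (i + (p - 1)) := by
    have := (hc.shift i).pred_ne_succ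
    rw [add_comm, add_comm 1] at this
    exact this.symm
  have hsub : ({c (i + 1), c (i + (p - 1))} : Set V) ⊆ H.neighborSet (c i) := by
    rintro y (rfl | rfl)
    · exact hc.adj i
    · exact (hc.adj_pred i).symm
  have heq := Set.eq_of_subset_of_ncard_le hsub (by rw [h2, Set.ncard_pair hne])
    (Set.finite_of_ncard_ne_zero (by omega))
  have : x ∈ ({c (i + 1), c (i + (p - 1))} : Set V) := heq ▸ hx
  exact this

/-- The cycle `c` has length `2` modulo `4` and weight `-1`. -/
def IsGoodCyc (M : Matrix V V ℂ) (p : ℕ) (c : ℕ → V) : Prop :=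
  p ≡ 2 [MOD 4] ∧ ∏ i ∈ Finset.range p, M (c i) (c (i + 1)) = -1

lemma isGoodCyc_of_even {M : Matrix V V ℂ} {k : ℕ} {c : ℕ → V} (hk : Odd k)
    (h : ∏ i ∈ Finset.range (2 * k), M (c i) (c (i + 1)) = (-1) ^ k) :
    IsGoodCyc M (2 * k) c := by
  refine ⟨?_, by rw [h, hk.neg_one_pow]⟩
  obtain ⟨j, rfl⟩ := hk
  show _ % _ = _ % _
  omega

/-- Hypotheses on the two weightings that are compared: `M` has unit gains and `N` is the ordinary
adjacency matrix. -/
structure IsGainPair (G : SimpleGraph V) (M N : Matrix V V ℂ) : Prop where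
  left : G.IsWeighting M
  right : G.IsWeighting N
  mul_eq_one : ∀ a b, G.Adj a b → M a b * M b a = 1
  right_eq_one : ∀ a b, G.Adj a b → N a b = 1

variable {G : SimpleGraph V} {M N : Matrix V V ℂ} {S : Set V}

lemma maskMat_apply_of_adj {M : Matrix V V ℂ} {a b : V} (h : (G.mask S).Adj a b) :
    M.maskMat S a b = M a b := by
  simp [maskMat, h.2.1, h.2.2]

lemma IsCyc.add_two_ne {H : SimpleGraph V} {p : ℕ} {c : ℕ → V} (hc : H.IsCyc p c) (i : ℕ) :
    c i ≠ c (i + 2) := by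
  intro h
  have := (hc.eq_iff _ _).1 h
  have h3 := hc.three_le
  have h0 : 0 ≡ 2 [MOD p] := Nat.ModEq.add_left_cancel' i (by simpa using this)
  have := h0.eq_of_lt_of_lt (by omega) (by omega)
  omega

lemma IsCyc.pred_add_one {H : SimpleGraph V} {p : ℕ} {c : ℕ → V} (hc : H.IsCyc p c) (i : ℕ) :
    c (i + 1 + (p - 1)) = c i := by
  rw [show i + 1 + (p - 1) = i + p by have := hc.three_le; omega, hc.add_period]

section Kernel

variable [Fintype V]

lemma IsCyc.mulVec_maskMat (hM : G.IsWeighting M) {p : ℕ} {c : ℕ → V}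
    (hc : (G.mask S).IsCyc p c)
    {i : ℕ} (hdeg : ∀ x, (G.mask S).Adj (c (i + 1)) x → x = c (i + 2) ∨ x = c i) (x : V → ℂ) :
    (M.maskMat S *ᵥ x) (c (i + 1)) =
      M (c (i + 1)) (c i) * x (c i) + M (c (i + 1)) (c (i + 2)) * x (c (i + 2)) := by
  rw [(hM.mask S).mulVec_eq_pair (hc.add_two_ne i), maskMat_apply_of_adj (hc.adj i).symm,
    maskMat_apply_of_adj (hc.adj (i + 1))]
  intro y hy h1 h2
  rcases hdeg y hy with h | h
  · exact absurd h h2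
  · exact absurd h h1

/-- The row at `c (i + 1)` expresses `z (c i)` through `z (c (i + 2))`; after `k` such double steps
one is back at `c 0`, and the accumulated factor must be 1. -/
lemma IsCyc.weight_of_mulVec_eq_zero (hP : G.IsGainPair M N) {k : ℕ} {c : ℕ → V}
    (hc : (G.mask S).IsCyc (2 * k) c)
    (hdeg : ∀ i x, (G.mask S).Adj (c (i + 1)) x → x = c (i + 2) ∨ x = c i) {z : V → ℂ}
    (hz : M.maskMat S *ᵥ z = 0) (hz0 : z (c 0) ≠ 0) :
    ∏ i ∈ Finset.range (2 * k), M (c i) (c (i + 1)) = (-1) ^ k := by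
  have hrec : ∀ i, z (c i) = - (M (c i) (c (i + 1)) * M (c (i + 1)) (c (i + 2))) *
      z (c (i + 2)) := by
    intro i
    have h1 := hc.mulVec_maskMat hP.left (hdeg i) z
    rw [hz] at h1
    have h2 := hP.mul_eq_one _ _ (hc.adj i).1
    simp only [Pi.zero_apply] at h1
    linear_combination (-z (c i)) * h2 - M (c i) (c (i + 1)) * h1
  have hprod : ∀ j, z (c 0) =
      (-1) ^ j * (∏ i ∈ Finset.range (2 * j), M (c i) (c (i + 1))) * z (c (2 * j)) := by
    intro j
    induction j with
    | zero => simp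
    | succ j ih =>
      rw [ih, hrec (2 * j), show 2 * (j + 1) = 2 * j + 1 + 1 by ring, Finset.prod_range_succ,
        Finset.prod_range_succ, pow_succ]
      ring
  have h := hprod k
  have hp := hc.add_period 0
  rw [zero_add] at hp
  rw [hp] at h
  have h1 : (-1 : ℂ) ^ k * ∏ i ∈ Finset.range (2 * k), M (c i) (c (i + 1)) = 1 := by
    apply mul_right_cancel₀ hz0
    rw [one_mul, ← h]
  have h2 : ((-1 : ℂ) ^ k) * (-1) ^ k = 1 := by rw [← mul_pow]; simp
  linear_combination (-1 : ℂ) ^ k * h1 - (∏ i ∈ Finset.range (2 * k), M (c i) (c (i + 1))) * h2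

/-- Rows other than that of `c 0` force `y` to change sign every two steps. For odd `p`, or `p`
divisible by 4, this makes `y (c (p - 1)) + y (c 1)`, the entry at `c 0`, vanish. -/
lemma IsCyc.exists_odd_of_mulVec (hP : G.IsGainPair M N) {p : ℕ} {c : ℕ → V}
    (hc : (G.mask S).IsCyc p c)
    (hdeg : ∀ i x, (G.mask S).Adj (c (i + 1)) x → x = c (i + 2) ∨ x = c i) {y : V → ℂ}
    (hy : ∀ w, w ≠ c 0 → (N.maskMat S *ᵥ y) w = 0) (hy0 : y (c 0) = 0)
    (hne : (N.maskMat S *ᵥ y) (c 0) ≠ 0) : ∃ k, p = 2 * k ∧ Odd k := by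
  have h3 := hc.three_le
  have hrow : ∀ i, (N.maskMat S *ᵥ y) (c (i + 1)) = y (c i) + y (c (i + 2)) := by
    intro i
    rw [hc.mulVec_maskMat hP.right (hdeg i), hP.right_eq_one _ _ (hc.adj i).1.symm,
      hP.right_eq_one _ _ (hc.adj (i + 1)).1, one_mul, one_mul]
  -- The bound keeps the row index `i + 1` strictly between 0 and `p`, away from `c 0`.
  have hrec : ∀ i, i + 2 ≤ p → y (c (i + 2)) = - y (c i) := by
    intro i hi
    have := hy (c (i + 1)) (hc.ne_of_lt (by omega) (by omega) (by omega))
    rw [hrow] at this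
    linear_combination this
  have hiter : ∀ a j, a + 2 * j ≤ p → y (c (a + 2 * j)) = (-1) ^ j * y (c a) := by
    intro a j
    induction j with
    | zero => simp
    | succ j ih =>
      intro h
      rw [show a + 2 * (j + 1) = a + 2 * j + 2 by ring, hrec _ (by omega), ih (by omega), pow_succ]
      ring
  have hlast : y (c (p - 1)) + y (c 1) ≠ 0 := by
    have h1 := hrow (p - 1)
    have hp := hc.add_period 0
    have hp1 := hc.add_period 1
    rw [zero_add] at hp
    rw [show p - 1 + 1 = p by omega, show p - 1 + 2 = 1 + p by omega, hp, hp1] at h1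
    rwa [← h1]
  rcases Nat.even_or_odd' p with ⟨k, rfl | rfl⟩
  · refine ⟨k, rfl, ?_⟩
    by_contra hodd
    rw [Nat.not_odd_iff_even] at hodd
    have := hiter 1 (k - 1) (by omega)
    rw [show 1 + 2 * (k - 1) = 2 * k - 1 by omega] at this
    apply hlast
    have h4 : Odd (k - 1) := Nat.Even.sub_odd (by omega) hodd odd_one
    rw [this, h4.neg_one_pow]
    ring
  · exfalso
    have h1 := hiter 0 k (by omega)
    have h2 := hiter 1 k (by omega)
    have hp := hc.add_period 0
    rw [zero_add] at hp h1
    rw [add_comm 1, hp, hy0] at h2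
    rw [hy0, mul_zero] at h1
    apply hlast
    rw [Nat.add_sub_cancel, h1, zero_add]
    exact (mul_eq_zero.1 h2.symm).resolve_left (by simp)

lemma LowerOptimal.isGoodCyc_of_component (hP : G.IsGainPair M N) (h : LowerOptimal G M N S)
    {p : ℕ} {c : ℕ → V} (hc : (G.mask S).IsCyc p c)
    (hdeg : ∀ i x, (G.mask S).Adj (c (i + 1)) x → x = c (i + 2) ∨ x = c i) :
    IsGoodCyc M p c := by
  classical
  obtain ⟨_, hMr, hNr, _⟩ := h.of_cycle hP.left hP.right hc 0
  rw [← maskMat_zeroAt] at hMr hNr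
  obtain ⟨z, hz, hz0⟩ := exists_of_rank_eq_rank_zeroAt hMr
  obtain ⟨y, hy, hy0, hne⟩ := exists_of_rank_eq_rank_zeroAt_add_two hNr
  obtain ⟨k, rfl, hk⟩ := hc.exists_odd_of_mulVec hP hdeg (y := y) (fun w hw => by
    rw [mulVec_eq_zeroAt_mulVec_add _ hw, hy, hy0]; simp) hy0 hne
  exact isGoodCyc_of_even hk (hc.weight_of_mulVec_eq_zero hP hdeg hz hz0)

end Kernel

/-! ### Structure of lower-optimal sets. -/

section Structure

variable [Fintype V]

omit [Fintype V] in
lemma neighborSet_mask_of_notMem {v : V} (hv : v ∉ S) : (G.mask S).neighborSet v = ∅ := by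
  ext x
  simp [mask_adj, hv]

lemma card_le_connectedComponent_mask (hS : S.Nonempty) :
    Nat.card V + 1 ≤ Nat.card (G.mask S).ConnectedComponent + S.ncard := by
  obtain ⟨s, hs⟩ := hS
  let f : Option (Sᶜ : Set V) → (G.mask S).ConnectedComponent
    | none => connectedComponentMk _ s
    | some v => connectedComponentMk _ (v : V)
  have hiso : ∀ v ∉ S, ∀ w, (G.mask S).Reachable v w → v = w := by
    rintro v hv w ⟨p⟩
    cases p with
    | nil => rfl
    | cons h _ => exact absurd h.2.1 hv
  have hf : Function.Injective f := by
    rintro (_ | ⟨v, hv⟩) (_ | ⟨w, hw⟩) h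
    · rfl
    · exact absurd hs (hiso w hw s (ConnectedComponent.exact h).symm ▸ hw)
    · exact absurd hs (hiso v hv s (ConnectedComponent.exact h) ▸ hv)
    · have := hiso v hv w (ConnectedComponent.exact h)
      subst this; rfl
  have h1 := Nat.card_le_card_of_injective f hf
  rw [Finite.card_option] at h1
  have h2 := Set.ncard_add_ncard_compl S
  have h3 : Nat.card (Sᶜ : Set V) = Sᶜ.ncard := rfl
  omega

open Classical in
/-- The excess over two of the degree of a vertex of `S`. -/
noncomputable def excess (G : SimpleGraph V) (S : Set V) (v : V) : ℤ :=
  ((G.mask S).neighborSet v).ncard - if v ∈ S then 2 else 0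

lemma sum_excess (G : SimpleGraph V) (S : Set V) :
    ∑ v, excess G S v = 2 * Nat.card (G.mask S).edgeSet - 2 * S.ncard := by
  classical
  unfold excess
  rw [Finset.sum_sub_distrib, ← Nat.cast_sum, sum_ncard_neighborSet, Finset.sum_ite]
  rw [Set.ncard_eq_toFinset_card' S]
  simp only [Nat.cast_mul, Nat.cast_ofNat, Finset.sum_const, nsmul_eq_mul, mul_zero, add_zero]
  rw [mul_comm ((Finset.card _ : ℕ) : ℤ)]
  congr 4
  ext; simp

/-- The degree sum is `2|E|`, and the mask has at least one component besides the isolated vertices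
outside `S`, so `|E| - |S| ≤ θ - 1`. -/
lemma sum_excess_le (hS : S.Nonempty) :
    ∑ v, excess G S v ≤ 2 * cycleDim (G.mask S) - 2 := by
  rw [sum_excess]
  have := card_le_connectedComponent_mask (G := G) hS
  unfold cycleDim
  omega

omit [Fintype V] in
lemma excess_nonneg (h : ∀ v ∈ S, 2 ≤ ((G.mask S).neighborSet v).ncard) (v : V) :
    0 ≤ excess G S v := by
  unfold excess
  split_ifs with hv
  · have := h v hv; omega
  · omega

omit [Fintype V] in
lemma ncard_of_excess {v : V} (hv : v ∈ S) :
    (((G.mask S).neighborSet v).ncard : ℤ) = excess G S v + 2 := by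
  simp [excess, hv]

/-- Each deletion of a cycle vertex lowers `cycleDim` by exactly 1. Cycles found afterwards avoid
that vertex, and since intersecting cycles have equal vertex sets, they avoid the whole earlier
cycle. -/
lemma LowerOptimal.exists_disjoint_cycles [DecidableEq V] (hP : G.IsGainPair M N)
    (h : LowerOptimal G M N S) :
    ∃ F : Finset (Finset V), cycleDim (G.mask S) ≤ F.card ∧
      (∀ C ∈ F, ∃ p c, (G.mask S).IsCyc p c ∧ Set.range c = (C : Set V)) ∧
      (F : Set (Finset V)).PairwiseDisjoint id := by
  classical
  induction hn : S.ncard using Nat.strong_induction_on generalizing S with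
  | _ n ih =>
    subst hn
    by_cases hac : (G.mask S).IsAcyclic
    · exact ⟨∅, by simpa using hac.cycleDim_le, by simp, by simp⟩
    obtain ⟨p, c, hc⟩ := exists_isCyc_of_not_isAcyclic hac
    obtain ⟨h1, _, _, h4⟩ := h.of_cycle hP.left hP.right hc 0
    obtain ⟨F, hF, hFc, hFd⟩ := ih _ (Set.ncard_lt_ncard (t := S) (s := S \ {c 0})
      ⟨Set.sdiff_subset, fun h => (h (hc.mem 0)).2 (by simp)⟩) h1 rfl
    have hdisj : ∀ C ∈ F, Disjoint (Set.range c) (C : Set V) := by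
      intro C hC
      obtain ⟨q, d, hd, hdC⟩ := hFc C hC
      rw [← hdC]
      by_contra hnd
      have hd' : (G.mask S).IsCyc q d := hd.mono fun i => mask_mono G Set.sdiff_subset (hd.adj i)
      have := h.range_eq hP.left hP.right hc hd' hnd
      have hmem : c 0 ∈ Set.range d := this ▸ ⟨0, rfl⟩
      obtain ⟨j, hj⟩ := hmem
      exact (hd.mem j).2 hj
    have hcoe : ((Set.range c).toFinset : Set V) = Set.range c := by simp
    refine ⟨insert (Set.range c).toFinset F, ?_, ?_, ?_⟩
    · rw [Finset.card_insert_of_notMem]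
      · push_cast; omega
      · intro hmem
        have := hdisj _ hmem
        rw [hcoe, disjoint_self] at this
        exact Set.range_nonempty c |>.ne_empty this
    · intro C hC
      rcases Finset.mem_insert.1 hC with rfl | hC
      · exact ⟨p, c, hc, hcoe.symm⟩
      · obtain ⟨q, d, hd, hdC⟩ := hFc C hC
        exact ⟨q, d, hd.mono fun i => mask_mono G Set.sdiff_subset (hd.adj i), hdC⟩
    · rw [Finset.coe_insert]
      refine hFd.insert fun C hC _ => ?_
      have := hdisj C hC
      rw [← hcoe, Finset.disjoint_coe] at this
      exact this

omit [Fintype V] in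
lemma neighborSet_mask_congr {S T : Set V} {v : V} (hv : v ∈ S ↔ v ∈ T)
    (h : ∀ x, G.Adj v x → v ∈ S → (x ∈ S ↔ x ∈ T)) :
    (G.mask S).neighborSet v = (G.mask T).neighborSet v := by
  ext x
  simp only [mem_neighborSet, mask_adj]
  have := h x
  tauto

/-- A vertex set inducing a graph without pendant vertices has all degrees zero or two. -/
def HasCycleShape (G : SimpleGraph V) (S : Set V) : Prop :=
  (∀ v, ((G.mask S).neighborSet v).ncard ≠ 1) →
    ∀ v, ((G.mask S).neighborSet v).ncard = 0 ∨ ((G.mask S).neighborSet v).ncard = 2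

omit [Fintype V] in
lemma isCycles_of_ncard {H : SimpleGraph V} [Finite V]
    (h : ∀ v, (H.neighborSet v).ncard = 0 ∨ (H.neighborSet v).ncard = 2) : H.IsCycles := by
  intro v hv
  refine (h v).resolve_left fun h0 => ?_
  rw [Set.ncard_eq_zero] at h0
  exact hv.ne_empty h0

/-- The pendant path is followed inwards. If the neighbour `z` of `y` becomes pendant in `L \ {y}`,
the same hypotheses hold there. Otherwise `L \ {y}` has no pendant vertex, so its shape puts `z` on
a cycle, which `LowerOptimal.of_pendant` forbids. -/
lemma LowerOptimal.false_of_single_pendant (hP : G.IsGainPair M N) (n : ℕ)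
    (ih : ∀ T : Set V, T.ncard < n → LowerOptimal G M N T → HasCycleShape G T)
    {L : Set V} {y : V} (hL : L.ncard ≤ n) (h : LowerOptimal G M N L)
    (h' : LowerOptimal G M N (L \ {y})) (hy : ((G.mask L).neighborSet y).ncard = 1)
    (hother : ∀ v, v ≠ y → ((G.mask L).neighborSet v).ncard ≠ 1) : False := by
  induction hm : L.ncard using Nat.strong_induction_on generalizing L y with
  | _ m ih' =>
    subst hm
    obtain ⟨z, hz⟩ := Set.ncard_eq_one.1 hy
    have hyz : (G.mask L).Adj y z := by rw [← mem_neighborSet, hz]; rfl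
    have hlt : (L \ {y}).ncard < L.ncard := Set.ncard_lt_ncard
      ⟨Set.sdiff_subset, fun h => (h hyz.2.1).2 (by simp)⟩
    obtain ⟨h1, _, h3⟩ := h.of_pendant hP.left hP.right hz
    have hzN : (G.mask (L \ {y})).neighborSet z = (G.mask L).neighborSet z \ {y} := by
      ext x
      have := hyz.ne
      simp only [mem_neighborSet, mask_adj, Set.mem_sdiff, Set.mem_singleton_iff]
      tauto
    have hzc : ((G.mask (L \ {y})).neighborSet z).ncard + 1 = ((G.mask L).neighborSet z).ncard := by
      rw [hzN]
      exact Set.ncard_sdiff_singleton_add_one hyz.symm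
    have hz1 := hother z hyz.ne.symm
    have hoth : ∀ v, v ≠ z → ((G.mask (L \ {y})).neighborSet v).ncard ≠ 1 := by
      intro v hv
      by_cases hvy : v = y
      · rw [neighborSet_mask_of_notMem (by simp [hvy])]; simp
      · rw [neighborSet_mask_congr (T := L) (by simp [hvy])]
        · exact hother v hvy
        · intro x hvx hvL
          have : x ∈ L → x ≠ y := by
            rintro hxL rfl
            have : v ∈ (G.mask L).neighborSet x := ⟨hvx.symm, hxL, hvL.1⟩
            rw [hz] at this
            exact hv this
          simp only [Set.mem_sdiff, Set.mem_singleton_iff]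
          tauto
    by_cases hz2 : ((G.mask (L \ {y})).neighborSet z).ncard = 1
    · refine ih' _ hlt (L := L \ {y}) (y := z) (by omega) h' ?_ hz2 hoth rfl
      rwa [← diff_pair, Set.pair_comm]
    · have hno : ∀ v, ((G.mask (L \ {y})).neighborSet v).ncard ≠ 1 := by
        intro v
        by_cases hv : v = z
        · rwa [hv]
        · exact hoth v hv
      have hshape := ih _ (by omega) h' hno
      have hpos : ((G.mask (L \ {y})).neighborSet z).Nonempty := by
        rw [← Set.ncard_pos]; omega
      obtain ⟨x, hx⟩ := hpos
      obtain ⟨p, c, hc, hc0, _⟩ := (isCycles_of_ncard hshape).exists_isCyc hx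
      exact h3 p c (hc.mono fun i => mask_mono G Set.sdiff_subset (hc.adj i)) ⟨0, hc0⟩

lemma exists_unique_excess {f : V → ℤ} (hf : ∀ v, 0 ≤ f v) {C : Finset V} (hC : C.Nonempty)
    (hsum : ∑ v ∈ C, f v ≤ 1) : ∃ x ∈ C, f x ≤ 1 ∧ ∀ v ∈ C, v ≠ x → f v = 0 := by
  classical
  have hle : ∀ v ∈ C, f v ≤ 1 := fun v hv =>
    (Finset.single_le_sum (fun w _ => hf w) hv).trans hsum
  by_cases h0 : ∀ v ∈ C, f v = 0
  · obtain ⟨x, hx⟩ := hC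
    exact ⟨x, hx, hle x hx, fun v hv _ => h0 v hv⟩
  · push Not at h0
    obtain ⟨x, hx, hx0⟩ := h0
    refine ⟨x, hx, hle x hx, fun v hv hvx => ?_⟩
    have h1 : ∑ w ∈ {v, x}, f w ≤ ∑ w ∈ C, f w :=
      Finset.sum_le_sum_of_subset_of_nonneg (by
        intro w hw
        rcases Finset.mem_insert.1 hw with rfl | hw
        · exact hv
        · rwa [Finset.mem_singleton.1 hw]) fun w _ _ => hf w
    rw [Finset.sum_pair hvx] at h1
    have := hf v
    have := hf x
    omega

/-- Pendant and isolated vertices are removed by induction, so all degrees in `S` may be taken at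
least 2. If `θ ≤ 1`, the excess sum is zero and cycles are components. If `θ ≥ 2`, goodness of a
cycle follows by deleting a vertex of a disjoint one. For the shape, some cycle has at most one edge
to the rest. Stripping it with and without its attaching vertex gives two lower-optimal sets, and a
connecting edge would make them contradict `LowerOptimal.false_of_single_pendant`. -/
lemma LowerOptimal.isGoodCyc_and_hasCycleShape (hP : G.IsGainPair M N) (h : LowerOptimal G M N S) :
    (∀ p c, (G.mask S).IsCyc p c → IsGoodCyc M p c) ∧ HasCycleShape G S := by
  classical
  induction hn : S.ncard using Nat.strong_induction_on generalizing S with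
  | _ n ih =>
    subst hn
    have hsub : ∀ {v : V}, v ∈ S → (S \ {v}).ncard < S.ncard := fun hv => Set.ncard_lt_ncard
      ⟨Set.sdiff_subset, fun h => (h hv).2 (by simp)⟩
    by_cases hpend : ∃ u, ((G.mask S).neighborSet u).ncard = 1
    · refine ⟨fun p c hc => ?_, fun hno => absurd hpend (by simpa using hno)⟩
      obtain ⟨u, hu⟩ := hpend
      obtain ⟨v, huv⟩ := Set.ncard_eq_one.1 hu
      have hadj : (G.mask S).Adj u v := by rw [← mem_neighborSet, huv]; rfl
      obtain ⟨h1, _, h3⟩ := h.of_pendant hP.left hP.right huv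
      have hlt : (S \ {u, v}).ncard < S.ncard := Set.ncard_lt_ncard
        ⟨Set.sdiff_subset, fun h => (h hadj.2.1).2 (by simp)⟩
      refine (ih _ hlt h1 rfl).1 p c (hc.of_mask.mask fun i => ⟨hc.mem i, ?_⟩)
      have hv := h3 p c hc
      rintro (hi | hi)
      · have := hc.adj i
        rw [hi, ← mem_neighborSet, huv] at this
        exact hv ⟨_, this⟩
      · exact hv ⟨_, hi⟩
    push Not at hpend
    by_cases hiso : ∃ s ∈ S, ((G.mask S).neighborSet s).ncard = 0
    · obtain ⟨s, hs, hs0⟩ := hiso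
      rw [Set.ncard_eq_zero] at hs0
      have hs' : ∀ x, ¬ (G.mask S).Adj s x := fun x hx => by
        rw [← mem_neighborSet, hs0] at hx; exact hx
      have h' : LowerOptimal G M N (S \ {s}) := by
        unfold LowerOptimal at h ⊢
        rwa [hP.left.maskMat_diff_of_isolated hs', hP.right.maskMat_diff_of_isolated hs',
          mask_diff_of_isolated hs']
      have := ih _ (hsub hs) h' rfl
      unfold HasCycleShape at this ⊢
      rwa [mask_diff_of_isolated hs'] at this
    push Not at hiso
    have hdeg2 : ∀ v ∈ S, 2 ≤ ((G.mask S).neighborSet v).ncard := by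
      intro v hv
      have h1 := hpend v
      have h2 := hiso v hv
      omega
    have hex := excess_nonneg hdeg2
    rcases Set.eq_empty_or_nonempty S with hS | hS
    · refine ⟨fun p c hc => absurd (hc.mem 0) (by simp [hS]), fun _ v => Or.inl ?_⟩
      rw [neighborSet_mask_of_notMem (by simp [hS])]; simp
    have hsum := sum_excess_le (G := G) hS
    by_cases hth : cycleDim (G.mask S) ≤ 1
    · have h0 : ∑ v, excess G S v = 0 :=
        le_antisymm (by omega) (Finset.sum_nonneg fun v _ => hex v)
      rw [Finset.sum_eq_zero_iff_of_nonneg fun v _ => hex v] at h0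
      have hall : ∀ v ∈ S, ((G.mask S).neighborSet v).ncard = 2 := by
        intro v hv
        have := ncard_of_excess (G := G) hv
        rw [h0 v (Finset.mem_univ _)] at this
        omega
      refine ⟨fun p c hc => h.isGoodCyc_of_component hP hc fun i x hx => ?_, fun _ v => ?_⟩
      · have := hc.eq_or_eq_of_ncard_eq_two (hall _ (hc.mem _)) hx
        rwa [hc.pred_add_one] at this
      · by_cases hv : v ∈ S
        · exact Or.inr (hall v hv)
        · left; rw [neighborSet_mask_of_notMem hv]; simp
    obtain ⟨F, hF, hFc, hFd⟩ := h.exists_disjoint_cycles hP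
    have hgood : ∀ p c, (G.mask S).IsCyc p c → IsGoodCyc M p c := by
      intro p c hc
      obtain ⟨C₁, hC₁, C₂, hC₂, hne⟩ := Finset.one_lt_card.1 (show 1 < F.card by omega)
      have hd12 := hFd hC₁ hC₂ hne
      obtain ⟨q, d, hd, hdc⟩ : ∃ q d, (G.mask S).IsCyc q d ∧
          Disjoint (Set.range c) (Set.range d) := by
        by_contra! hcon
        obtain ⟨q₁, d₁, hd₁, hr₁⟩ := hFc _ hC₁
        obtain ⟨q₂, d₂, hd₂, hr₂⟩ := hFc _ hC₂
        have e₁ := h.range_eq hP.left hP.right hc hd₁ (hcon _ _ hd₁)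
        have e₂ := h.range_eq hP.left hP.right hc hd₂ (hcon _ _ hd₂)
        apply hne
        rw [← Finset.coe_inj, ← hr₁, ← hr₂, e₁, e₂]
      obtain ⟨h1, _⟩ := h.of_cycle hP.left hP.right hd 0
      refine (ih _ (hsub (hd.mem 0)) h1 rfl).1 p c (hc.of_mask.mask fun i => ⟨hc.mem i, ?_⟩)
      intro hi
      exact Set.disjoint_left.1 hdc ⟨i, rfl⟩ ⟨0, hi.symm⟩
    refine ⟨hgood, fun _ => ?_⟩
    -- The total excess is at most `2θ - 2`, less than twice the number of disjoint cycles.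
    obtain ⟨C, hC, hCsum⟩ : ∃ C ∈ F, ∑ v ∈ C, excess G S v ≤ 1 := by
      by_contra! hcon
      have h1 : ∑ C ∈ F, ∑ v ∈ C, excess G S v ≤ ∑ v, excess G S v := by
        have hU := Finset.sum_biUnion (f := excess G S) hFd
        simp only [id] at hU
        rw [← hU]
        exact Finset.sum_le_sum_of_subset_of_nonneg (Finset.subset_univ _) fun v _ _ => hex v
      have h2 : F.card • (2 : ℤ) ≤ ∑ C ∈ F, ∑ v ∈ C, excess G S v :=
        Finset.card_nsmul_le_sum _ _ _ fun C hC => by have := hcon C hC; omega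
      rw [nsmul_eq_mul] at h2
      omega
    obtain ⟨p, c', hc', hr'⟩ := hFc C hC
    obtain ⟨x, hxC, hx1, hx0⟩ := exists_unique_excess hex (C := C) (by
      rw [← Finset.coe_nonempty, ← hr']; exact Set.range_nonempty _) hCsum
    obtain ⟨k, hk⟩ : x ∈ Set.range c' := by rw [hr']; exact hxC
    obtain ⟨c, hc, hc0, hr⟩ : ∃ c, (G.mask S).IsCyc p c ∧ c 0 = x ∧ Set.range c ⊆ (C : Set V) := by
      refine ⟨_, hc'.shift k, by simpa using hk, ?_⟩
      rintro _ ⟨i, rfl⟩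
      rw [← hr']
      exact ⟨_, rfl⟩
    obtain ⟨m, rfl⟩ : ∃ m, p = 2 * m := by
      have h4 : p % 4 = 2 := (hgood p c hc).1
      exact ⟨p / 2, by omega⟩
    have h3 := hc.three_le
    have hdegc : ∀ i, 0 < i → i < 2 * m → ((G.mask S).neighborSet (c i)).ncard = 2 := by
      intro i hi him
      have h1 := hx0 (c i) (hr ⟨i, rfl⟩) (by
        rw [← hc0]; exact hc.ne_of_lt him (by omega) (by omega))
      have h2 := ncard_of_excess (G := G) (hc.mem i)
      rw [h1] at h2
      omega
    have hnbr : ∀ i, 0 < i → i < 2 * m → ∀ y, (G.mask S).Adj (c i) y →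
        y = c (i - 1) ∨ y = c (i + 1) := by
      intro i hi him y hy
      have := hc.eq_or_eq_of_ncard_eq_two (hdegc i hi him) hy
      rw [show i + (2 * m - 1) = i - 1 + 2 * m by omega, hc.add_period] at this
      exact this.symm
    obtain ⟨T, hT, hTi, hTd⟩ := hc.steps_delete_zero hnbr
    have hLT := ((h.of_cycle hP.left hP.right hc 0).1).of_steps hP.left hP.right hT
    -- The vertex `c (2 * m - 1)` left over by the pendant steps is isolated, so removing it changes
    -- neither rank nor `cycleDim`.
    have hLC : LowerOptimal G M N (S \ Set.range c) := by
      unfold LowerOptimal at hLT ⊢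
      rwa [← hTd, hP.left.maskMat_diff_of_isolated hTi, hP.right.maskMat_diff_of_isolated hTi,
        mask_diff_of_isolated hTi]
    have hCmem : ∀ v, (∀ i, 0 < i → i < 2 * m → c i ≠ v) → v ∈ Set.range c → v = c 0 := by
      intro v hv hvr
      obtain ⟨i, hi, rfl⟩ := hc.exists_lt_of_mem_range hvr
      rcases Nat.eq_zero_or_pos i with rfl | hi0
      · rfl
      · exact absurd rfl (hv i hi0 hi)
    have hinner : ∀ v, v ∉ Set.range c → ∀ y, (G.mask S).Adj v y → y ∈ Set.range c → y = c 0 := by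
      intro v hv y hvy hy
      refine hCmem y (fun i hi him hiy => ?_) hy
      subst hiy
      rcases hnbr i hi him v hvy.symm with rfl | rfl
      · exact hv ⟨_, rfl⟩
      · exact hv ⟨_, rfl⟩
    have hLK := ((h.of_cycle hP.left hP.right hc 1).1).of_steps hP.left hP.right
      (hc.steps_delete_one hnbr)
    set K := S \ (Set.range c \ {c 0}) with hK
    have hKsub : K ⊆ S := Set.sdiff_subset
    have hKlt : K.ncard < S.ncard := Set.ncard_lt_ncard
      ⟨hKsub, fun hle => (hle (hc.mem 1)).2 ⟨⟨1, rfl⟩,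
        hc.ne_of_lt (by omega) (by omega) (by omega)⟩⟩
    have hK0 : K \ {c 0} = S \ Set.range c := by
      ext v
      simp only [hK, Set.mem_sdiff, Set.mem_singleton_iff]
      constructor
      · rintro ⟨⟨h1, h2⟩, h3⟩
        exact ⟨h1, fun h => h2 ⟨h, h3⟩⟩
      · rintro ⟨h1, h2⟩
        exact ⟨⟨h1, fun h => h2 h.1⟩, fun h => h2 ⟨0, h.symm⟩⟩
    have hKout : ∀ v, v ∉ Set.range c →
        (G.mask K).neighborSet v = (G.mask S).neighborSet v := by
      intro v hv
      refine neighborSet_mask_congr ⟨fun h => h.1, fun h => ⟨h, fun h => hv h.1⟩⟩ ?_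
      intro y hvy hvK
      refine ⟨fun h => h.1, fun hy => ⟨hy, fun hyc => ?_⟩⟩
      exact hyc.2 (hinner v hv y ⟨hvy, hvK.1, hy⟩ hyc.1)
    have hKin : ∀ v ∈ Set.range c, v ≠ c 0 → (G.mask K).neighborSet v = ∅ := fun v hv hv0 =>
      neighborSet_mask_of_notMem fun h => h.2 ⟨hv, hv0⟩
    have hKc : (G.mask S).neighborSet (c 0) =
        insert (c 1) (insert (c (2 * m - 1)) ((G.mask K).neighborSet (c 0))) := by
      ext y
      simp only [mem_neighborSet, Set.mem_insert_iff]
      constructor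
      · intro hy
        by_cases hyc : y ∈ Set.range c
        · obtain ⟨i, hi, rfl⟩ := hc.exists_lt_of_mem_range hyc
          have hi0 : 0 < i := by
            rcases Nat.eq_zero_or_pos i with rfl | h
            · exact absurd rfl hy.ne
            · exact h
          rcases hnbr i hi0 hi _ hy.symm with h | h
          · have := hc.eq_of_lt (by omega) (by omega) h
            left; congr 1; omega
          · have h5 : i = 2 * m - 1 := by
              by_contra hne
              have := hc.eq_of_lt (by omega) (by omega) h
              omega
            exact Or.inr (Or.inl (h5 ▸ rfl))
        · exact Or.inr (Or.inr ⟨hy.1, ⟨hy.2.1, fun h => h.2 rfl⟩, hy.2.2, fun h => hyc h.1⟩)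
      · rintro (rfl | rfl | hy)
        · exact hc.adj 0
        · simpa using (hc.adj_pred 0).symm
        · exact mask_mono G hKsub hy
    have hKcard : ((G.mask S).neighborSet (c 0)).ncard =
        ((G.mask K).neighborSet (c 0)).ncard + 2 := by
      have hn : ∀ i, 0 < i → i < 2 * m → c i ∉ (G.mask K).neighborSet (c 0) := by
        intro i hi him hmem
        exact hmem.2.2.2 ⟨⟨i, rfl⟩, hc.ne_of_lt (by omega) (by omega) (by omega)⟩
      rw [hKc, Set.ncard_insert_of_notMem, Set.ncard_insert_of_notMem]
      · exact hn _ (by omega) (by omega)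
      · rw [Set.mem_insert_iff]
        rintro (h | h)
        · exact hc.pred_ne_succ h.symm
        · exact hn _ (by omega) (by omega) h
    have hc0e := ncard_of_excess (G := G) (hc.mem 0)
    rw [hc0] at hc0e
    rw [← hc0] at hx1 hc0e
    have hx1' := hex (c 0)
    by_cases hK1 : ((G.mask K).neighborSet (c 0)).ncard = 1
    -- A connecting edge at `c 0` would make it the only pendant vertex of `K`, while both `K` and
    -- `K \ {c 0} = S \ Set.range c` are lower-optimal.
    · refine absurd ?_ not_false
      refine false_of_single_pendant hP S.ncard (fun T hT hTl => (ih _ hT hTl rfl).2)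
        (L := K) (y := c 0) hKlt.le hLK (hK0 ▸ hLC) hK1 ?_
      intro v hv
      by_cases hvc : v ∈ Set.range c
      · rw [hKin v hvc hv]; simp
      · rw [hKout v hvc]; exact hpend v
    -- The excess of `c 0` in `S` is its degree in `K`, hence at most 1. So the cycle is a full
    -- component, and the rest inherits its shape from `K`.
    · have hK00 : ((G.mask K).neighborSet (c 0)).ncard = 0 := by omega
      have hno : ∀ v, ((G.mask K).neighborSet v).ncard ≠ 1 := by
        intro v
        by_cases hv : v = c 0
        · rw [hv]; omega
        by_cases hvc : v ∈ Set.range c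
        · rw [hKin v hvc hv]; simp
        · rw [hKout v hvc]; exact hpend v
      have hshape := (ih _ hKlt hLK rfl).2 hno
      intro v
      by_cases hvc : v ∈ Set.range c
      · obtain ⟨i, hi, rfl⟩ := hc.exists_lt_of_mem_range hvc
        rcases Nat.eq_zero_or_pos i with rfl | hi0
        · right; omega
        · exact Or.inr (hdegc i hi0 hi)
      · rw [← hKout v hvc]; exact hshape v

end Structure

end SimpleGraph

/-! ### Reduction by pendant steps, and the converse for disjoint good cycles. -/

namespace SimpleGraph

variable {V : Type*} [Fintype V] {G : SimpleGraph V} {M N : Matrix V V ℂ} {S : Set V}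

lemma LowerOptimal.exists_steps (hP : G.IsGainPair M N) (h : LowerOptimal G M N S) :
    ∃ T, Relation.ReflTransGen (PendantStep G) S T ∧
      cycleDim (G.mask T) = cycleDim (G.mask S) ∧
      ∀ v, ((G.mask T).neighborSet v).ncard = 0 ∨ ((G.mask T).neighborSet v).ncard = 2 := by
  induction hn : S.ncard using Nat.strong_induction_on generalizing S with
  | _ n ih =>
    subst hn
    by_cases hpend : ∃ u, ((G.mask S).neighborSet u).ncard = 1
    · obtain ⟨u, hu⟩ := hpend
      obtain ⟨v, huv⟩ := Set.ncard_eq_one.1 hu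
      have hadj : (G.mask S).Adj u v := by rw [← mem_neighborSet, huv]; rfl
      obtain ⟨h1, h2, _⟩ := h.of_pendant hP.left hP.right huv
      have hlt : (S \ {u, v}).ncard < S.ncard := Set.ncard_lt_ncard
        ⟨Set.sdiff_subset, fun h => (h hadj.2.1).2 (by simp)⟩
      obtain ⟨T, hT, hd, hT'⟩ := ih _ hlt h1 rfl
      exact ⟨T, Relation.ReflTransGen.head ⟨u, v, huv, rfl⟩ hT, hd.trans h2, hT'⟩
    · push Not at hpend
      exact ⟨S, Relation.ReflTransGen.refl, rfl, (h.isGoodCyc_and_hasCycleShape hP).2 hpend⟩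

lemma rank_add_rank_of_steps (hM : G.IsWeighting M) (hN : G.IsWeighting N) {T : Set V}
    (hST : Relation.ReflTransGen (PendantStep G) S T) :
    (M.maskMat S).rank + (N.maskMat T).rank = (M.maskMat T).rank + (N.maskMat S).rank := by
  induction hST with
  | refl => exact add_comm _ _ |>.trans (add_comm _ _)
  | tail _ hs ih =>
    obtain ⟨u, v, huv, rfl⟩ := hs
    have h1 := hM.rank_pendant huv
    have h2 := hN.rank_pendant huv
    omega

omit [Fintype V] in
lemma IsCyc.exists_vec {H : SimpleGraph V} {p : ℕ} {c : ℕ → V} (hc : H.IsCyc p c) (a : ℕ → ℂ) :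
    ∃ x : V → ℂ, (∀ i < p, x (c i) = a i) ∧ ∀ v, v ∉ Set.range c → x v = 0 := by
  classical
  refine ⟨fun v => if h : ∃ i < p, c i = v then a h.choose else 0, fun i hi => ?_, fun v hv => ?_⟩
  · have h : ∃ j < p, c j = c i := ⟨i, hi, rfl⟩
    simp only [dif_pos h]
    rw [hc.eq_of_lt h.choose_spec.1 hi h.choose_spec.2]
  · refine dif_neg ?_
    rintro ⟨i, _, rfl⟩
    exact hv ⟨i, rfl⟩

section Component

variable {c : ℕ → V}

lemma IsCyc.mulVec_eq_zero_of_notMem {p : ℕ} (hM : G.IsWeighting M) (hc : (G.mask S).IsCyc p c)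
    (hdeg : ∀ i x, (G.mask S).Adj (c (i + 1)) x → x = c (i + 2) ∨ x = c i) {x : V → ℂ}
    (hx : ∀ v, v ∉ Set.range c → x v = 0) {w : V} (hw : w ∉ Set.range c) :
    (M.maskMat S *ᵥ x) w = 0 := by
  refine (hM.mask S).mulVec_eq_zero fun y hwy => ?_
  by_contra hne
  have hy : y ∈ Set.range c := by_contra fun h => hne (hx y h)
  obtain ⟨i, rfl⟩ := hy
  rw [← hc.add_period, show i + p = i + (p - 1) + 1 by have := hc.three_le; omega] at hwy
  rcases hdeg _ w hwy.symm with rfl | rfl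
  · exact hw ⟨_, rfl⟩
  · exact hw ⟨_, rfl⟩

/-- The vector is supported on even positions and solves the two-step recursion of the rows. The
weight `(-1) ^ m` is exactly what makes it `2 * m`-periodic. -/
lemma IsCyc.exists_kernel_vector {m : ℕ} (hP : G.IsGainPair M N)
    (hc : (G.mask S).IsCyc (2 * m) c)
    (hdeg : ∀ i x, (G.mask S).Adj (c (i + 1)) x → x = c (i + 2) ∨ x = c i)
    (hgood : ∏ i ∈ Finset.range (2 * m), M (c i) (c (i + 1)) = (-1) ^ m) :
    ∃ z : V → ℂ, M.maskMat S *ᵥ z = 0 ∧ z (c 0) ≠ 0 := by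
  have h3 := hc.three_le
  set P : ℕ → ℂ := fun i => ∏ k ∈ Finset.range i, M (c k) (c (k + 1)) with hPdef
  set a : ℕ → ℂ := fun i => if Even i then (-1) ^ (i / 2) * (P i)⁻¹ else 0 with ha
  have hone : ((-1 : ℂ) ^ m) * (-1) ^ m = 1 := by rw [← mul_pow]; simp
  have hper : ∀ i, a (i + 2 * m) = a i := by
    intro i
    have h1 : P (i + 2 * m) = (-1) ^ m * P i := by
      simp only [hPdef]
      rw [add_comm i, Finset.prod_range_add, hgood]
      congr 1
      refine Finset.prod_congr rfl fun k _ => ?_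
      rw [add_comm (2 * m) k, hc.add_period, show k + 2 * m + 1 = k + 1 + 2 * m by ring,
        hc.add_period]
    simp only [ha]
    by_cases hi : Even i
    · have hi' : Even (i + 2 * m) := hi.add (by simp)
      rw [if_pos hi, if_pos hi', h1, show (i + 2 * m) / 2 = i / 2 + m by omega, pow_add, mul_inv]
      have : ((-1 : ℂ) ^ m)⁻¹ = (-1) ^ m := inv_eq_of_mul_eq_one_left hone
      rw [this]
      linear_combination (-1 : ℂ) ^ (i / 2) * (P i)⁻¹ * hone
    · have hi' : ¬ Even (i + 2 * m) := by
        rw [Nat.even_add]; simp [hi]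
      rw [if_neg hi, if_neg hi']
  obtain ⟨z, hz, hz0⟩ := hc.exists_vec a
  have hzc : ∀ i, z (c i) = a i := by
    intro i
    have hi : c i = c (i % (2 * m)) := (hc.eq_iff _ _).2 (Nat.mod_modEq _ _).symm
    have h4 : ∀ j k, a (j + 2 * m * k) = a j := by
      intro j k
      induction k with
      | zero => simp
      | succ k ih => rw [show j + 2 * m * (k + 1) = j + 2 * m * k + 2 * m by ring, hper, ih]
    have h5 := h4 (i % (2 * m)) (i / (2 * m))
    rw [Nat.mod_add_div] at h5
    rw [hi, hz _ (Nat.mod_lt _ (by omega)), h5]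
  refine ⟨z, ?_, ?_⟩
  · ext w
    by_cases hw : w ∈ Set.range c
    · obtain ⟨i, rfl⟩ := hw
      rw [← hc.add_period, show i + 2 * m = (i + (2 * m - 1)) + 1 by omega]
      generalize i + (2 * m - 1) = i
      rw [hc.mulVec_maskMat hP.left (hdeg i), hzc, hzc]
      simp only [ha]
      by_cases hi : Even i
      · have hi' : Even (i + 2) := hi.add (by simp)
        have e1 := hP.mul_eq_one _ _ (hc.adj i).1
        have e2 := hP.mul_eq_one _ _ (hc.adj (i + 1)).1
        have n1 : M (c i) (c (i + 1)) ≠ 0 := left_ne_zero_of_mul_eq_one e1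
        have n2 : M (c (i + 1)) (c (i + 2)) ≠ 0 := left_ne_zero_of_mul_eq_one e2
        have e3 : M (c (i + 1)) (c i) = (M (c i) (c (i + 1)))⁻¹ := eq_inv_of_mul_eq_one_right e1
        rw [if_pos hi, if_pos hi', show (i + 2) / 2 = i / 2 + 1 by omega, pow_succ]
        simp only [hPdef]
        rw [Finset.prod_range_succ, Finset.prod_range_succ, e3, mul_inv, mul_inv]
        rw [show i + 1 + 1 = i + 2 by ring]
        simp only [Pi.zero_apply]
        field_simp
        ring
      · have hi' : ¬ Even (i + 2) := by rw [Nat.even_add]; simp [hi]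
        rw [if_neg hi, if_neg hi']; simp
    · exact hc.mulVec_eq_zero_of_notMem hP.left hdeg hz0 hw
  · rw [hzc]; simp [ha, hPdef]

/-- The values `0, 1, 0, -1, …` cancel in every row but that of `c 0`, where oddness of `m` gives `1
+ 1`. -/
lemma IsCyc.exists_cokernel_vector {m : ℕ} (hP : G.IsGainPair M N) (hm : Odd m)
    (hc : (G.mask S).IsCyc (2 * m) c)
    (hdeg : ∀ i x, (G.mask S).Adj (c (i + 1)) x → x = c (i + 2) ∨ x = c i) :
    ∃ y : V → ℂ, (∀ w, w ≠ c 0 → (N.maskMat S *ᵥ y) w = 0) ∧ y (c 0) = 0 ∧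
      (N.maskMat S *ᵥ y) (c 0) ≠ 0 := by
  have h3 := hc.three_le
  set a : ℕ → ℂ := fun i => if Even i then 0 else (-1) ^ (i / 2) with ha
  obtain ⟨y, hy, hy0⟩ := hc.exists_vec a
  have hp := hc.add_period 0
  rw [zero_add] at hp
  have hyc : ∀ i ≤ 2 * m, y (c i) = a i := by
    intro i hi
    rcases hi.lt_or_eq with h | rfl
    · exact hy i h
    · rw [hp, hy 0 (by omega)]; simp [ha]
  have hrow : ∀ i, (N.maskMat S *ᵥ y) (c (i + 1)) = y (c i) + y (c (i + 2)) := by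
    intro i
    rw [hc.mulVec_maskMat hP.right (hdeg i), hP.right_eq_one _ _ (hc.adj i).1.symm,
      hP.right_eq_one _ _ (hc.adj (i + 1)).1, one_mul, one_mul]
  refine ⟨y, fun w hw => ?_, ?_, ?_⟩
  · by_cases hwc : w ∈ Set.range c
    · obtain ⟨i, hi, rfl⟩ := hc.exists_lt_of_mem_range hwc
      obtain ⟨j, rfl⟩ : ∃ j, i = j + 1 := by
        rcases Nat.eq_zero_or_pos i with rfl | h
        · exact absurd rfl hw
        · exact ⟨i - 1, by omega⟩
      rw [hrow, hyc _ (by omega), hyc _ (by omega)]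
      simp only [ha]
      by_cases hj : Even j
      · have hj' : Even (j + 2) := hj.add (by simp)
        rw [if_pos hj, if_pos hj', zero_add]
      · have hj' : ¬ Even (j + 2) := by rw [Nat.even_add]; simp [hj]
        rw [if_neg hj, if_neg hj', show (j + 2) / 2 = j / 2 + 1 by omega, pow_succ]
        ring
    · exact hc.mulVec_eq_zero_of_notMem hP.right hdeg hy0 hwc
  · rw [hyc 0 (by omega)]; simp [ha]
  · have h1 := hrow (2 * m - 1)
    have hp1 := hc.add_period 1
    rw [show 2 * m - 1 + 1 = 2 * m by omega, show 2 * m - 1 + 2 = 1 + 2 * m by omega, hp, hp1,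
      hyc _ (by omega), hyc _ (by omega)] at h1
    rw [h1]
    obtain ⟨k, rfl⟩ := hm
    have hodd : ¬ Even (2 * (2 * k + 1) - 1) := by rw [Nat.not_even_iff]; omega
    simp only [ha, if_neg hodd, show (2 * (2 * k + 1) - 1) / 2 = 2 * k by omega]
    norm_num

/-- The vertices are deleted in order: the first has degree 2 and costs at most 1, each later one
has at most one neighbour left and costs nothing. -/
lemma IsCyc.cycleDim_le_add_one {p : ℕ} (hc : (G.mask S).IsCyc p c)
    (hdeg : ∀ i, ((G.mask S).neighborSet (c i)).ncard = 2) :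
    cycleDim (G.mask S) ≤ cycleDim (G.mask (S \ Set.range c)) + 1 := by
  have h3 := hc.three_le
  have key : ∀ k, k < p →
      cycleDim (G.mask S) ≤ cycleDim (G.mask (S \ c '' {i | i ≤ k})) + 1 := by
    intro k
    induction k with
    | zero =>
      intro _
      have := cycleDim_le_delete (G.mask S) (u := c 0)
      rw [hdeg, ← mask_diff_singleton] at this
      have himg : c '' {i | i ≤ 0} = {c 0} := by ext; simp
      rw [himg]
      simpa using this
    | succ k ih =>
      intro hk
      refine (ih (by omega)).trans ?_
      have h1 := cycleDim_le_delete (G.mask (S \ c '' {i | i ≤ k})) (u := c (k + 1))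
      have h2 : ((G.mask (S \ c '' {i | i ≤ k})).neighborSet (c (k + 1))).ncard ≤ 1 := by
        refine (Set.ncard_le_ncard (t := {c (k + 2)}) ?_).trans (by simp)
        intro x hx
        rcases hc.eq_or_eq_of_ncard_eq_two (hdeg (k + 1)) (mask_mono G Set.sdiff_subset hx)
          with h | h
        · exact h
        · rw [hc.pred_add_one] at h
          exact absurd ⟨k, by simp, h.symm⟩ hx.2.2.2
      rw [← mask_diff_singleton] at h1
      have himg : S \ c '' {i | i ≤ k + 1} = (S \ c '' {i | i ≤ k}) \ {c (k + 1)} := by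
        ext x
        simp only [Set.mem_sdiff, Set.mem_image, Set.mem_ofPred_eq, not_exists, not_and,
          Set.mem_singleton_iff]
        constructor
        · rintro ⟨h1, h2⟩
          exact ⟨⟨h1, fun i hi => h2 i (by omega)⟩, fun h => h2 _ le_rfl h.symm⟩
        · rintro ⟨⟨h1, h2⟩, h3⟩
          refine ⟨h1, fun i hi => ?_⟩
          rcases hi.lt_or_eq with h | rfl
          · exact h2 i (by omega)
          · exact fun h => h3 h.symm
      rw [himg]
      have h4 : ((((G.mask (S \ c '' {i | i ≤ k})).neighborSet (c (k + 1))).ncard - 1 : ℕ) : ℤ)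
          = 0 := by omega
      rw [h4] at h1
      omega
  have himg : c '' {i | i ≤ p - 1} = Set.range c := by
    ext x
    constructor
    · rintro ⟨i, _, rfl⟩; exact ⟨i, rfl⟩
    · intro hx
      obtain ⟨i, hi, rfl⟩ := hc.exists_lt_of_mem_range hx
      exact ⟨i, by simp only [Set.mem_ofPred_eq]; omega, rfl⟩
  have := key (p - 1) (by omega)
  rwa [himg] at this

end Component

/-- One cycle component is peeled off at a time. Deleting `c 0` costs `N` rank 2 and `M` nothing,
the pendant steps then cost both the same, and `θ` drops by at most 1. This gives one inequality;
`IsWeighting.rank_sub_le` gives the other. -/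
theorem lowerOptimal_of_ncard (hP : G.IsGainPair M N)
    (hgood : ∀ (u : V) (w : G.Walk u u), w.IsCycle →
      IsGoodCyc M w.length (fun i => w.getVert (i % w.length)))
    (hdeg : ∀ v, ((G.mask S).neighborSet v).ncard = 0 ∨ ((G.mask S).neighborSet v).ncard = 2) :
    LowerOptimal G M N S := by
  classical
  induction hn : S.ncard using Nat.strong_induction_on generalizing S with
  | _ n ih =>
    subst hn
    by_cases hE : ∃ a b, (G.mask S).Adj a b
    · obtain ⟨p, c, hc, hcg⟩ : ∃ p c, (G.mask S).IsCyc p c ∧ IsGoodCyc M p c := by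
        obtain ⟨a, b, hab⟩ := hE
        obtain ⟨w, hw, _⟩ :=
          (isCycles_of_ncard hdeg).exists_cycle_toSubgraph_verts_eq_connectedComponentSupp
          (c := (G.mask S).connectedComponentMk a) (v := a) rfl ⟨b, hab⟩
        have hle : G.mask S ≤ G := fun _ _ h => h.1
        refine ⟨_, _, hw.isCyc, ?_⟩
        have := hgood a (w.mapLe hle) ((Walk.isCycle_mapLe hle).2 hw)
        simpa [Walk.mapLe, Walk.getVert_map] using this
      have h3 := hc.three_le
      have hdeg2 : ∀ i, ((G.mask S).neighborSet (c i)).ncard = 2 := fun i =>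
        (hdeg (c i)).resolve_left fun h0 => by
          rw [Set.ncard_eq_zero] at h0
          have : c (i + 1) ∈ (G.mask S).neighborSet (c i) := hc.adj i
          rw [h0] at this
          exact this
      have hnbr : ∀ i x, (G.mask S).Adj (c (i + 1)) x → x = c (i + 2) ∨ x = c i := by
        intro i x hx
        have := hc.eq_or_eq_of_ncard_eq_two (hdeg2 _) hx
        rwa [hc.pred_add_one] at this
      obtain ⟨hp4, hprod⟩ := hcg
      have hp4' : p % 4 = 2 := hp4
      obtain ⟨m, rfl⟩ : ∃ m, p = 2 * m := ⟨p / 2, by omega⟩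
      have hm : Odd m := by rw [Nat.odd_iff]; omega
      obtain ⟨z, hz, hz0⟩ := hc.exists_kernel_vector hP hnbr (by rw [hprod, hm.neg_one_pow])
      obtain ⟨y, hy, hy0, hyne⟩ := hc.exists_cokernel_vector hP hm hnbr
      have hMr := rank_eq_rank_zeroAt (hP.left.mask S).isHermitian hz hz0
      have hNr := rank_eq_rank_zeroAt_add_two (hP.right.mask S).isHermitian (u := c 0) (y := y)
        (by
          ext w
          by_cases hw : w = c 0
          · rw [hw, zeroAt_mulVec_self]; rfl
          · have := mulVec_eq_zeroAt_mulVec_add (N.maskMat S) hw y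
            rw [hy w hw, hy0] at this
            simpa using this.symm) hy0 hyne
      rw [maskMat_zeroAt] at hMr hNr
      obtain ⟨T, hT, hTi, hTd⟩ := hc.steps_delete_zero (fun i hi _ x hx => by
        have := hnbr (i - 1) x
        rw [Nat.sub_add_cancel hi, show i - 1 + 2 = i + 1 by omega] at this
        exact (this hx).symm)
      have hrk := rank_add_rank_of_steps hP.left hP.right hT
      rw [← hP.left.maskMat_diff_of_isolated hTi, ← hP.right.maskMat_diff_of_isolated hTi,
        hTd] at hrk
      have hdim := hc.cycleDim_le_add_one hdeg2
      have hlow := hP.left.rank_sub_le hP.right S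
      have hout : ∀ v, v ∉ Set.range c →
          (G.mask (S \ Set.range c)).neighborSet v = (G.mask S).neighborSet v := by
        intro v hv
        refine neighborSet_mask_congr ⟨fun h => h.1, fun h => ⟨h, hv⟩⟩ fun x hvx hvS => ?_
        refine ⟨fun h => h.1, fun h => ⟨h, ?_⟩⟩
        rintro ⟨i, rfl⟩
        have hadj : (G.mask S).Adj (c i) v := ⟨hvx.symm, h, hvS.1⟩
        rw [← hc.add_period, show i + 2 * m = i + (2 * m - 1) + 1 by omega] at hadj
        rcases hnbr _ _ hadj with rfl | rfl
        · exact hv ⟨_, rfl⟩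
        · exact hv ⟨_, rfl⟩
      have hrest := ih _ (Set.ncard_lt_ncard (t := S) (s := S \ Set.range c)
        ⟨Set.sdiff_subset, fun h => (h (hc.mem 0)).2 ⟨0, rfl⟩⟩) (S := S \ Set.range c)
        (fun v => by
          by_cases hv : v ∈ Set.range c
          · left
            rw [neighborSet_mask_of_notMem (fun h => h.2 hv)]; simp
          · rw [hout v hv]; exact hdeg v) rfl
      unfold LowerOptimal at hrest ⊢
      omega
    · push Not at hE
      have h1 : N.maskMat S = 0 := by
        ext a b; exact (hP.right.mask S).eq_zero (hE a b)
      have h1' : M.maskMat S = 0 := by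
        ext a b; exact (hP.left.mask S).eq_zero (hE a b)
      have h2 : G.mask S = ⊥ := by ext a b; simp [hE]
      unfold LowerOptimal
      rw [h1, h1', h2, cycleDim_bot]
      simp

end SimpleGraph

/-! ### Disjoint unions of cycles read off from degrees. -/

namespace SimpleGraph

section Components

variable {W : Type*} {H : SimpleGraph W}

lemma fin_val_sub_eq_one_iff {p : ℕ} (hp : 3 ≤ p) (u v : Fin p) :
    (u - v).val = 1 ↔ (u : ℕ) ≡ v + 1 [MOD p] := by
  have hu := u.2
  have hv := v.2
  rw [Fin.sub_def, Nat.ModEq, Nat.mod_eq_of_lt hu]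
  have h2 : ((v : ℕ) + 1) % p = if (v : ℕ) + 1 = p then 0 else (v : ℕ) + 1 := by
    split_ifs with h
    · rw [h, Nat.mod_self]
    · exact Nat.mod_eq_of_lt (by omega)
  have h1 : (p - (v : ℕ) + u) % p =
      if (v : ℕ) ≤ u then (u : ℕ) - v else p - (v : ℕ) + u := by
    split_ifs with h
    · rw [show p - (v : ℕ) + u = (u - v) + p by omega, Nat.add_mod_right,
        Nat.mod_eq_of_lt (by omega)]
    · exact Nat.mod_eq_of_lt (by omega)
  rw [h2]
  simp only [h1]
  split_ifs <;> omega

lemma IsCyc.isCycleGraph {p : ℕ} {c : ℕ → W} (hc : H.IsCyc p c) {C : H.ConnectedComponent}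
    (hr : Set.range c = C.supp) (hdeg : ∀ i, (H.neighborSet (c i)).ncard = 2) :
    IsCycleGraph C.toSimpleGraph := by
  have h3 := hc.three_le
  let f : Fin p → C := fun i => ⟨c i, by
    show c i ∈ C.supp
    rw [← hr]; exact ⟨i, rfl⟩⟩
  have hf : Function.Bijective f := by
    constructor
    · intro i j hij
      exact Fin.ext (hc.eq_of_lt i.2 j.2 (congrArg Subtype.val hij))
    · rintro ⟨x, hx⟩
      have hx' : x ∈ Set.range c := by rw [hr]; exact hx
      obtain ⟨i, hi, rfl⟩ := hc.exists_lt_of_mem_range hx'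
      exact ⟨⟨i, hi⟩, rfl⟩
  have hadj : ∀ i j : Fin p, H.Adj (c i) (c j) ↔ (cycleGraph p).Adj i j := by
    intro i j
    rw [cycleGraph_adj', fin_val_sub_eq_one_iff h3, fin_val_sub_eq_one_iff h3, ← hc.eq_iff,
      ← hc.eq_iff]
    constructor
    · intro h
      rcases hc.eq_or_eq_of_ncard_eq_two (hdeg i) h with h | h
      · exact Or.inr h
      · left
        rw [hc.eq_iff] at h ⊢
        have h5 : (j : ℕ) + 1 ≡ i + (p - 1) + 1 [MOD p] := h.add_right 1
        rw [show (i : ℕ) + (p - 1) + 1 = i + p by omega] at h5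
        exact (h5.trans (by simp [Nat.ModEq])).symm
    · rintro (h | h)
      · rw [h]; exact (hc.adj j).symm
      · rw [h]; exact hc.adj i
  refine ⟨p, h3, ⟨(RelIso.mk (Equiv.ofBijective f hf) ?_ : cycleGraph p ≃g C.toSimpleGraph).symm⟩⟩
  intro i j
  exact hadj i j

lemma ncard_neighborSet_of_isCycleGraph {v : W}
    (h : IsCycleGraph (H.connectedComponentMk v).toSimpleGraph) :
    (H.neighborSet v).ncard = 2 := by
  obtain ⟨p, hp, ⟨e⟩⟩ := h
  obtain ⟨n, rfl⟩ : ∃ n, p = n + 3 := ⟨p - 3, by omega⟩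
  let C := H.connectedComponentMk v
  let v' : C := ⟨v, rfl⟩
  have h1 : H.neighborSet v = Subtype.val '' (C.toSimpleGraph.neighborSet v') := by
    ext x
    constructor
    · intro hx
      exact ⟨⟨x, C.mem_supp_of_adj_mem_supp rfl hx⟩, hx, rfl⟩
    · rintro ⟨y, hy, rfl⟩
      exact hy
  have h2 : C.toSimpleGraph.neighborSet v' = e ⁻¹' ((cycleGraph (n + 3)).neighborSet (e v')) := by
    ext x
    exact e.map_adj_iff.symm
  have h3 : ((cycleGraph (n + 3)).neighborSet (e v')).ncard = 2 := by
    rw [Set.ncard_eq_toFinset_card']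
    exact cycleGraph_degree_three_le
  rw [h1, Set.ncard_image_of_injective _ Subtype.val_injective, h2,
    Set.ncard_preimage_of_injective_subset_range e.injective (by
      rw [e.surjective.range_eq]; exact Set.subset_univ _), h3]

variable [Finite W]

lemma isCycleGraph_of_ncard
    (h : ∀ v, (H.neighborSet v).ncard = 0 ∨ (H.neighborSet v).ncard = 2) {v : W}
    (hv : (H.neighborSet v).ncard = 2) :
    IsCycleGraph (H.connectedComponentMk v).toSimpleGraph := by
  obtain ⟨w, hw⟩ := Set.nonempty_of_ncard_ne_zero (s := H.neighborSet v) (by omega)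
  obtain ⟨p, c, hc, _, hr⟩ := (isCycles_of_ncard h).exists_isCyc hw
  refine hc.isCycleGraph hr fun i => (h _).resolve_left fun h0 => ?_
  rw [Set.ncard_eq_zero] at h0
  have : c (i + 1) ∈ H.neighborSet (c i) := hc.adj i
  rw [h0] at this
  exact this

omit [Finite W] in
lemma supp_eq_singleton {v : W} (hv : ∀ x, ¬ H.Adj v x) :
    (H.connectedComponentMk v).supp = {v} := by
  ext x
  rw [ConnectedComponent.mem_supp_iff, ConnectedComponent.eq, Set.mem_singleton_iff]
  constructor
  · intro h
    obtain ⟨p⟩ := h.symm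
    cases p with
    | nil => rfl
    | cons h _ => exact absurd h (hv _)
  · rintro rfl; exact Reachable.refl _

lemma not_adj_of_ncard_eq_zero {v : W} (hv : (H.neighborSet v).ncard = 0) (x : W) :
    ¬ H.Adj v x := by
  rw [Set.ncard_eq_zero] at hv
  intro h
  rw [← mem_neighborSet, hv] at h
  exact h

/-- With degrees 0 and 2, `|E|` is the number of vertices of degree 2, so `|V| - |E|` counts
isolated vertices, which are exactly the components that are not cycles. -/
lemma card_isCycleGraph_eq_cycleDim
    (h : ∀ v, (H.neighborSet v).ncard = 0 ∨ (H.neighborSet v).ncard = 2) :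
    (Nat.card {C : H.ConnectedComponent // IsCycleGraph C.toSimpleGraph} : ℤ) = cycleDim H := by
  classical
  have := Fintype.ofFinite W
  have hiff : ∀ v, IsCycleGraph (H.connectedComponentMk v).toSimpleGraph ↔
      (H.neighborSet v).ncard = 2 := fun v =>
    ⟨ncard_neighborSet_of_isCycleGraph, isCycleGraph_of_ncard h⟩
  have hcomp : Nat.card {C : H.ConnectedComponent // IsCycleGraph C.toSimpleGraph} +
      Nat.card {C : H.ConnectedComponent // ¬ IsCycleGraph C.toSimpleGraph} =
      Nat.card H.ConnectedComponent := by
    rw [← Nat.card_sum]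
    exact Nat.card_congr (Equiv.sumCompl _)
  have hvert : Nat.card {v : W // (H.neighborSet v).ncard = 2} +
      Nat.card {v : W // ¬ (H.neighborSet v).ncard = 2} = Nat.card W := by
    rw [← Nat.card_sum]
    exact Nat.card_congr (Equiv.sumCompl _)
  have hiso : Nat.card {v : W // ¬ (H.neighborSet v).ncard = 2} =
      Nat.card {C : H.ConnectedComponent // ¬ IsCycleGraph C.toSimpleGraph} := by
    refine Nat.card_congr (Equiv.ofBijective
      (fun v => ⟨H.connectedComponentMk v, fun hC => v.2 ((hiff _).1 hC)⟩) ⟨?_, ?_⟩)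
    · rintro ⟨v, hv⟩ ⟨w, hw⟩ hvw
      have h1 : H.connectedComponentMk v = H.connectedComponentMk w := congrArg Subtype.val hvw
      have h2 := supp_eq_singleton (not_adj_of_ncard_eq_zero ((h v).resolve_right hv))
      have h3 : w ∈ (H.connectedComponentMk v).supp := h1.symm
      rw [h2] at h3
      exact Subtype.ext (Set.mem_singleton_iff.1 h3).symm
    · rintro ⟨C, hC⟩
      induction C using ConnectedComponent.ind with | _ v =>
      exact ⟨⟨v, fun hv => hC ((hiff v).2 hv)⟩, rfl⟩
  have hsum := sum_ncard_neighborSet (H := H)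
  have hsum' : ∑ v, (H.neighborSet v).ncard =
      2 * Nat.card {v : W // (H.neighborSet v).ncard = 2} := by
    rw [Nat.card_eq_fintype_card, Fintype.card_subtype, mul_comm, ← smul_eq_mul,
      ← Finset.sum_const, Finset.sum_filter]
    refine Finset.sum_congr rfl fun v _ => ?_
    rcases h v with h0 | h0 <;> simp [h0]
  unfold cycleDim
  omega

lemma isDisjointUnionOfCycles_iff {k : ℤ} : IsDisjointUnionOfCycles H k ↔
    (∀ v, (H.neighborSet v).ncard = 0 ∨ (H.neighborSet v).ncard = 2) ∧ k = cycleDim H := by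
  constructor
  · rintro ⟨h1, h2⟩
    have h : ∀ v, (H.neighborSet v).ncard = 0 ∨ (H.neighborSet v).ncard = 2 := by
      intro v
      rcases h1 (H.connectedComponentMk v) with hC | ⟨w, hw⟩
      · exact Or.inr (ncard_neighborSet_of_isCycleGraph hC)
      · left
        rw [Set.ncard_eq_zero]
        have hv : v ∈ (H.connectedComponentMk v).supp := rfl
        rw [hw, Set.mem_singleton_iff] at hv
        ext x
        simp only [mem_neighborSet, Set.mem_empty_iff_false, iff_false]
        intro hx
        have hx' : x ∈ (H.connectedComponentMk v).supp :=
          ConnectedComponent.mem_supp_of_adj_mem_supp _ rfl hx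
        rw [hw, Set.mem_singleton_iff] at hx'
        exact hx.ne (hv.trans hx'.symm)
    exact ⟨h, h2.symm.trans (card_isCycleGraph_eq_cycleDim h)⟩
  · rintro ⟨h, rfl⟩
    refine ⟨fun C => ?_, card_isCycleGraph_eq_cycleDim h⟩
    induction C using ConnectedComponent.ind with | _ v =>
    rcases h v with h0 | h2
    · exact Or.inr ⟨v, supp_eq_singleton (not_adj_of_ncard_eq_zero h0)⟩
    · exact Or.inl (isCycleGraph_of_ncard h h2)

end Components

/-! ### Passage between masks and induced subgraphs. -/

section Induce

variable {V : Type*} {G : SimpleGraph V} {S : Set V}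

lemma neighborSet_mask_coe (u : S) :
    (G.mask S).neighborSet u = Subtype.val '' ((G.induce S).neighborSet u) := by
  ext x
  constructor
  · rintro ⟨h, _, hx⟩
    exact ⟨⟨x, hx⟩, h, rfl⟩
  · rintro ⟨y, hy, rfl⟩
    exact ⟨hy, u.2, y.2⟩

lemma ncard_neighborSet_mask_coe (u : S) :
    ((G.mask S).neighborSet u).ncard = ((G.induce S).neighborSet u).ncard := by
  rw [neighborSet_mask_coe, Set.ncard_image_of_injective _ Subtype.val_injective]

lemma pendantStep_iff_deltaStep {T : Set V} : PendantStep G S T ↔ DeltaStep G S T := by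
  constructor
  · rintro ⟨u, v, huv, rfl⟩
    have hadj : (G.mask S).Adj u v := by rw [← mem_neighborSet, huv]; rfl
    refine ⟨⟨u, hadj.2.1⟩, ⟨v, hadj.2.2⟩, ?_, hadj.1, rfl⟩
    have := ncard_neighborSet_mask_coe (G := G) (S := S) ⟨u, hadj.2.1⟩
    rw [huv, Set.ncard_singleton] at this
    exact this.symm
  · rintro ⟨u, v, hu, hadj, rfl⟩
    refine ⟨u, v, ?_, rfl⟩
    obtain ⟨w, hw⟩ := Set.ncard_eq_one.1 hu
    have : v ∈ (G.induce S).neighborSet u := hadj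
    rw [hw, Set.mem_singleton_iff] at this
    rw [neighborSet_mask_coe, hw, this, Set.image_singleton]

lemma pendantStep_eq_deltaStep : PendantStep G = DeltaStep G := by
  ext; exact pendantStep_iff_deltaStep

lemma reachable_induce_of_mask {x y : V} (w : (G.mask S).Walk x y) (hx : x ∈ S) (hy : y ∈ S) :
    (G.induce S).Reachable ⟨x, hx⟩ ⟨y, hy⟩ := by
  induction w with
  | nil => exact Reachable.refl _
  | @cons a b c h w ih =>
    have hadj : (G.induce S).Adj ⟨a, hx⟩ ⟨b, h.2.2⟩ := h.1
    exact hadj.reachable.trans (ih h.2.2 hy)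

lemma eq_of_reachable_mask {x y : V} (h : (G.mask S).Reachable x y) (hx : x ∉ S) : x = y := by
  obtain ⟨p⟩ := h
  cases p with
  | nil => rfl
  | cons h _ => exact absurd h.2.1 hx

variable [Fintype V]

lemma card_connectedComponent_mask : Nat.card (G.mask S).ConnectedComponent =
    Nat.card (G.induce S).ConnectedComponent + Nat.card (Sᶜ : Set V) := by
  let φ : G.induce S →g G.mask S := ⟨Subtype.val, fun {a b} h => ⟨h, a.2, b.2⟩⟩
  let f : (G.induce S).ConnectedComponent ⊕ (Sᶜ : Set V) → (G.mask S).ConnectedComponent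
    | Sum.inl C => C.map φ
    | Sum.inr v => connectedComponentMk _ (v : V)
  rw [← Nat.card_sum]
  refine (Nat.card_congr (Equiv.ofBijective f ⟨?_, ?_⟩)).symm
  · rintro (C | ⟨v, hv⟩) (D | ⟨w, hw⟩) h
    · induction C using ConnectedComponent.ind with | _ a =>
      induction D using ConnectedComponent.ind with | _ b =>
      obtain ⟨p⟩ := ConnectedComponent.exact h
      exact congrArg _ (ConnectedComponent.sound (reachable_induce_of_mask p a.2 b.2))
    · induction C using ConnectedComponent.ind with | _ a =>
      have : w = a := eq_of_reachable_mask (ConnectedComponent.exact h).symm hw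
      exact absurd a.2 (this ▸ hw)
    · induction D using ConnectedComponent.ind with | _ b =>
      have : v = b := eq_of_reachable_mask (ConnectedComponent.exact h) hv
      exact absurd b.2 (this ▸ hv)
    · have := eq_of_reachable_mask (ConnectedComponent.exact h) hv
      subst this; rfl
  · intro C
    induction C using ConnectedComponent.ind with | _ a =>
    by_cases ha : a ∈ S
    · exact ⟨Sum.inl (connectedComponentMk _ ⟨a, ha⟩), rfl⟩
    · exact ⟨Sum.inr ⟨a, ha⟩, rfl⟩

lemma cycleDim_induce : cycleDim (G.induce S) = cycleDim (G.mask S) := by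
  classical
  have h1 : Nat.card (G.induce S).edgeSet = Nat.card (G.mask S).edgeSet := by
    have e1 := sum_ncard_neighborSet (H := G.induce S)
    have e2 := sum_ncard_neighborSet (H := G.mask S)
    have e3 : ∑ v, ((G.mask S).neighborSet v).ncard =
        ∑ v : S, ((G.induce S).neighborSet v).ncard := by
      simp only [← ncard_neighborSet_mask_coe]
      rw [Finset.sum_set_coe (s := S) (f := fun v => ((G.mask S).neighborSet v).ncard)]
      symm
      refine Finset.sum_subset (Finset.subset_univ _) fun v _ hv => ?_
      rw [Set.mem_toFinset] at hv
      rw [neighborSet_mask_of_notMem hv, Set.ncard_empty]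
    omega
  have h2 := card_connectedComponent_mask (G := G) (S := S)
  have h3 := Set.ncard_add_ncard_compl S
  have h4 : Nat.card (Sᶜ : Set V) = Sᶜ.ncard := rfl
  have h5 : Nat.card S = S.ncard := rfl
  unfold cycleDim
  omega

end Induce

end SimpleGraph

/-! ### Specialisation to gain graphs, and the theorem. -/

namespace SimpleGraph

variable {V : Type*} {G : SimpleGraph V}

lemma isWeighting_adjMatrix [DecidableRel G.Adj] : G.IsWeighting (G.adjMatrix ℂ) where
  isHermitian := by
    ext a b
    simp only [conjTranspose_apply, adjMatrix_apply, G.adj_comm b a]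
    split_ifs <;> simp
  ne_zero_iff a b := by simp [adjMatrix_apply]

lemma Walk.toSubgraph_eq_of_adj {u v : V} {w : G.Walk u u} {w' : G.Walk v v} (hw : ¬ w.Nil)
    (hw' : ¬ w'.Nil)
    (h : ∀ i < w.length, w'.toSubgraph.Adj (w.getVert i) (w.getVert (i + 1)))
    (h' : ∀ i < w'.length, w.toSubgraph.Adj (w'.getVert i) (w'.getVert (i + 1))) :
    w.toSubgraph = w'.toSubgraph := by
  have key : ∀ {u v : V} {w : G.Walk u u} {w' : G.Walk v v}, ¬ w.Nil →
      (∀ i < w.length, w'.toSubgraph.Adj (w.getVert i) (w.getVert (i + 1))) →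
      w.toSubgraph ≤ w'.toSubgraph := by
    intro u v w w' hw h
    rw [Walk.toSubgraph_le_iff hw]
    intro e he
    induction e using Sym2.ind with | _ a b =>
    rw [Walk.mem_edgeSet, ← Walk.adj_toSubgraph_iff_mem_edges, Walk.toSubgraph_adj_iff] at he
    obtain ⟨i, hi, hil⟩ := he
    rw [← hi, Subgraph.mem_edgeSet]
    exact h i hil
  exact le_antisymm (key hw h) (key hw' h')

end SimpleGraph

namespace TGainGraph

variable {V : Type*} (Φ : TGainGraph V)

lemma adjMatrix_of_adj {a b : V} (h : Φ.graph.Adj a b) :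
    Φ.adjMatrix a b = (Φ.gain ⟨(a, b), h⟩ : ℂ) := by
  simp [adjMatrix, h]

lemma adjMatrix_symm {a b : V} (h : Φ.graph.Adj a b) :
    Φ.adjMatrix b a = ((Φ.gain ⟨(a, b), h⟩)⁻¹ : Circle) := by
  rw [Φ.adjMatrix_of_adj h.symm, ← Φ.gain_symm]
  rfl

lemma isGainPair [DecidableRel Φ.graph.Adj] :
    Φ.graph.IsGainPair Φ.adjMatrix (Φ.graph.adjMatrix ℂ) where
  left :=
    { isHermitian := by
        ext a b
        rw [conjTranspose_apply]
        by_cases h : Φ.graph.Adj a b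
        · rw [Φ.adjMatrix_symm h, Φ.adjMatrix_of_adj h, Circle.coe_inv_eq_conj]
          simp
        · have h' : ¬ Φ.graph.Adj b a := fun hb => h hb.symm
          simp [adjMatrix, h, h']
      ne_zero_iff := fun a b => by
        by_cases h : Φ.graph.Adj a b
        · rw [Φ.adjMatrix_of_adj h]; simp [h]
        · simp [adjMatrix, h] }
  right := isWeighting_adjMatrix
  mul_eq_one a b h := by
    rw [Φ.adjMatrix_symm h, Φ.adjMatrix_of_adj h, ← Circle.coe_mul, mul_inv_cancel,
      Circle.coe_one]
  right_eq_one a b h := by simp [h]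

lemma coe_walkGain {u v : V} (w : Φ.graph.Walk u v) : (Φ.walkGain w : ℂ) =
    ∏ i ∈ Finset.range w.length, Φ.adjMatrix (w.getVert i) (w.getVert (i + 1)) := by
  induction w with
  | nil => simp [walkGain]
  | @cons a b c h w ih =>
    rw [Walk.length_cons, Finset.prod_range_succ', mul_comm]
    simp only [Walk.getVert_cons_succ, Walk.getVert_zero, ← ih]
    rw [Φ.adjMatrix_of_adj h]
    simp [walkGain]

/-- Length 2 modulo 4 makes half the length odd, so the Type A value `(-1) ^ (p / 2)` is `-1`. -/
lemma isGoodCyc_iff {u : V} {w : Φ.graph.Walk u u} :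
    IsGoodCyc Φ.adjMatrix w.length (fun i => w.getVert (i % w.length)) ↔
      Φ.IsTypeA w ∧ w.length ≡ 2 [MOD 4] := by
  have hprod : ∏ i ∈ Finset.range w.length, Φ.adjMatrix (w.getVert (i % w.length))
      (w.getVert ((i + 1) % w.length)) = Φ.walkGain w := by
    rw [coe_walkGain]
    refine Finset.prod_congr rfl fun i hi => ?_
    have hi' := Finset.mem_range.1 hi
    rw [Nat.mod_eq_of_lt hi']
    congr 1
    rcases Nat.lt_or_ge (i + 1) w.length with h | h
    · rw [Nat.mod_eq_of_lt h]
    · rw [show i + 1 = w.length by omega, Nat.mod_self, Walk.getVert_zero, Walk.getVert_length]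
  unfold IsGoodCyc IsTypeA
  rw [hprod]
  have hpar : w.length ≡ 2 [MOD 4] → Even w.length ∧ Odd (w.length / 2) := by
    intro h
    have h' : w.length % 4 = 2 := h
    rw [Nat.even_iff, Nat.odd_iff]
    omega
  constructor
  · rintro ⟨h1, h2⟩
    obtain ⟨h3, h4⟩ := hpar h1
    exact ⟨⟨h3, by rw [h2, h4.neg_one_pow]⟩, h1⟩
  · rintro ⟨⟨_, h2⟩, h1⟩
    exact ⟨h1, by rw [h2, (hpar h1).2.neg_one_pow]⟩

variable {Φ} [Fintype V]

lemma isLowerOptimal_iff [DecidableRel Φ.graph.Adj] : Φ.IsLowerOptimal ↔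
    LowerOptimal Φ.graph Φ.adjMatrix (Φ.graph.adjMatrix ℂ) Set.univ := by
  unfold IsLowerOptimal LowerOptimal rank graphRank
  rw [maskMat_univ, maskMat_univ, mask_univ]
  convert Iff.rfl

end TGainGraph

namespace SimpleGraph

variable {V : Type*} [Fintype V] {G : SimpleGraph V} {M N : Matrix V V ℂ}

/-- Equal vertex sets alone would not suffice here: `LowerOptimal.succ_eq` shows that every edge of
one cycle is an edge of the other, so the subgraphs agree. -/
lemma LowerOptimal.cyclesVertexDisjoint (hP : G.IsGainPair M N)
    (h : LowerOptimal G M N Set.univ) : CyclesVertexDisjoint G := by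
  rintro _ ⟨u, w, hw, rfl⟩ _ ⟨v, w', hw', rfl⟩ hne
  by_contra hnd
  apply hne
  have hd : ¬ Disjoint (Set.range fun i => w.getVert (i % w.length))
      (Set.range fun i => w'.getVert (i % w'.length)) := by
    rw [hw.range_getVert_mod, hw'.range_getVert_mod]
    rwa [Walk.verts_toSubgraph, Walk.verts_toSubgraph] at hnd
  have key : ∀ {u v : V} {w : G.Walk u u} {w' : G.Walk v v}, w.IsCycle → w'.IsCycle →
      (¬ Disjoint (Set.range fun i => w.getVert (i % w.length))
      (Set.range fun i => w'.getVert (i % w'.length))) →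
      ∀ i < w'.length, w.toSubgraph.Adj (w'.getVert i) (w'.getVert (i + 1)) := by
    intro u v w w' hw hw' hd i hi
    have hc := hw.isCyc.mask (S := Set.univ) fun _ => trivial
    have hc' := hw'.isCyc.mask (S := Set.univ) fun _ => trivial
    have h3 := hw.three_le_length
    have hstep : ∀ l, w.toSubgraph.Adj (w.getVert (l % w.length))
        (w.getVert ((l + 1) % w.length)) := by
      intro l
      have hlt : l % w.length < w.length := Nat.mod_lt _ (by omega)
      have := w.toSubgraph_adj_getVert hlt
      rcases Nat.lt_or_ge (l % w.length + 1) w.length with h | h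
      · rwa [Nat.add_mod, Nat.mod_eq_of_lt (show 1 < w.length by omega), Nat.mod_eq_of_lt h]
      · have h4 : l % w.length + 1 = w.length := by omega
        rw [Nat.add_mod, Nat.mod_eq_of_lt (show 1 < w.length by omega), h4, Nat.mod_self,
          Walk.getVert_zero]
        rwa [h4, Walk.getVert_length] at this
    have hmem := h.range_subset hP.left hP.right hc hc' hd ⟨i, rfl⟩
    obtain ⟨l, hl⟩ := hmem
    have hi' : w'.getVert ((i + 1) % w'.length) = w'.getVert (i + 1) := by
      rcases Nat.lt_or_ge (i + 1) w'.length with h | h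
      · rw [Nat.mod_eq_of_lt h]
      · rw [show i + 1 = w'.length by omega, Nat.mod_self, Walk.getVert_zero,
          Walk.getVert_length]
    have hs := h.succ_eq hP.left hP.right hc hc' hl
    simp only [hi', Nat.mod_eq_of_lt hi] at hs hl
    rw [← hl]
    rcases hs with hs | hs
    · rw [hs]; exact hstep l
    · rw [hs]
      have := hstep (l + (w.length - 1))
      rw [show l + (w.length - 1) + 1 = l + w.length by omega, Nat.add_mod_right] at this
      exact this.symm
  exact Walk.toSubgraph_eq_of_adj hw.not_nil hw'.not_nil (key hw' hw fun h => hd h.symm)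
    (key hw hw' hd)

end SimpleGraph

theorem theorem4p8 {V : Type*} [Fintype V] (Φ : TGainGraph V) :
    Φ.IsLowerOptimal ↔
      GraphRank.CyclesVertexDisjoint Φ.graph ∧
      (∀ (u : V) (w : Φ.graph.Walk u u), w.IsCycle →
        Φ.IsTypeA w ∧ w.length ≡ 2 [MOD 4]) ∧
      (∃ S : Set V, GraphRank.IsCrucial Φ.graph S ∧
        GraphRank.IsDisjointUnionOfCycles (Φ.graph.induce S)
          (GraphRank.cycleDim Φ.graph)) := by
  classical
  have hP := Φ.isGainPair
  rw [TGainGraph.isLowerOptimal_iff]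
  constructor
  · intro h
    refine ⟨h.cyclesVertexDisjoint hP, fun u w hw => ?_, ?_⟩
    · rw [← TGainGraph.isGoodCyc_iff]
      refine (h.isGoodCyc_and_hasCycleShape hP).1 _ _ ?_
      rw [mask_univ]
      exact hw.isCyc
    · obtain ⟨S, hS, hdim, hdeg⟩ := h.exists_steps hP
      rw [pendantStep_eq_deltaStep] at hS
      have hdeg' : ∀ v : S, ((Φ.graph.induce S).neighborSet v).ncard = 0 ∨
          ((Φ.graph.induce S).neighborSet v).ncard = 2 := fun v => by
        rw [← ncard_neighborSet_mask_coe]; exact hdeg v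
      refine ⟨S, ⟨hS, fun u hu => ?_⟩, isDisjointUnionOfCycles_iff.2 ⟨hdeg', ?_⟩⟩
      · have hu' : ((Φ.graph.induce S).neighborSet u).ncard = 1 := hu
        have := hdeg' u
        omega
      · rw [cycleDim_induce, hdim, mask_univ]
  · rintro ⟨_, hcyc, S, ⟨hS, _⟩, hU⟩
    rw [isDisjointUnionOfCycles_iff, cycleDim_induce] at hU
    obtain ⟨hdeg, hdim⟩ := hU
    rw [← pendantStep_eq_deltaStep] at hS
    have hlow : LowerOptimal Φ.graph Φ.adjMatrix (Φ.graph.adjMatrix ℂ) S := by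
      refine lowerOptimal_of_ncard hP (fun u w hw => Φ.isGoodCyc_iff.2 (hcyc u w hw)) fun v => ?_
      by_cases hv : v ∈ S
      · have := hdeg ⟨v, hv⟩
        rwa [← ncard_neighborSet_mask_coe] at this
      · rw [neighborSet_mask_of_notMem hv]; simp
    -- The steps preserve the difference of the two ranks, and the cycle count `hdim` says that `θ`
    -- is the same on `S` as on the whole graph.
    have hrk := rank_add_rank_of_steps hP.left hP.right hS
    unfold LowerOptimal at hlow ⊢
    rw [mask_univ, hdim]
    omega
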